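/- **Proposition 3.1 (conservation of instantaneous charges).** Let $(\Sigma,\gamma)$ be a smooth three-dimensional Riemannian manifold (the Cauchy surface), let $V\subseteq\Sigma$, and let $X$ be a vector field, smooth in a neighbourhood of $V$, which is conformal Killing on $V$, i.e. $\mathcal L_X\gamma=\lambda\gamma$ on $V$ for some function $\lambda$. Let $T_{ij}$ be a tensor field, smooth in a neighbourhood of $V$, which on $V$ is symmetric ($T_{ij}=T_{ji}$), traceless ($\gamma^{ij}T_{ij}=0$) and divergence-free ($T^i{}_{j|i}=0$, where $|$ is the Levi-Civita covariant derivative of $\gamma$). This applies to $T=E$, the electric part of the Weyl tensor, and to $T=B$, its magnetic part, whenever the tensor in question is divergence-free on $V$. A *closed surface* is a compact embedded smooth two-dimensional submanifold $A\subset\Sigma$ without boundary, oriented by a continuous unit normal field $n$; the instantaneous charge is $$I(T,X)[A]=\int_A T^i{}_jX^j\,dS_i,\qquad dS_i=n_i\,dA,$$ where $dA$ is the Riemannian area measure of $A$. Two closed surfaces $A_1,A_2$ *limit a volume in $V$* if they are disjoint and there is a compact region $W\subseteq V$ with smooth boundary $\partial W=A_1\cup A_2$, the normal of $A_2$ pointing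 out of $W$ and the normal of $A_1$ pointing into $W$. Call two closed surfaces *homologous in $V$* if they are related by the equivalence relation which this generates. Then for every closed surface $A\subseteq V$ the integrand $T^i{}_jX^jn_i$ is integrable over $A$, and the charge does not depend on the choice of the closed surface in its class: if $A_1,A_2\subseteq V$ are closed surfaces that are homologous in $V$, then $$\int_{A_1}T^i{}_jX^j\,dS_i=\int_{A_2}T^i{}_jX^j\,dS_i .$$ -/

import Mathlib

open Set MeasureTheory Manifold Bundle
open scoped ContDiff

noncomputable section

/-- The coordinate space `ℝ³`. -/
abbrev E3 : Type := EuclideanSpace ℝ (Fin 3)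

section Fields

variable (M : Type*) [TopologicalSpace M] [ChartedSpace E3 M]

/-- Vector fields `X^i` on a three-dimensional manifold (no regularity imposed here). -/
abbrev VecField : Type _ := (x : M) → TangentSpace (𝓡 3) x

/-- Covariant 2-tensor fields `T_{ij}` on a three-dimensional manifold (no regularity imposed
here): `T x v w` is `T_{ij} v^i w^j` at the point `x`. -/
abbrev CovTensor2 : Type _ :=
  (x : M) → TangentSpace (𝓡 3) x →L[ℝ] TangentSpace (𝓡 3) x →L[ℝ] ℝ

/-- Smooth Riemannian metrics on a smooth three-dimensional manifold. -/
abbrev Metric3 [IsManifold (𝓡 3) ∞ M] : Type _ :=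
  ContMDiffRiemannianMetric (𝓡 3) ∞ E3 (fun x : M => TangentSpace (𝓡 3) x)

/-- The smooth coordinate systems of `M`: all charts of the maximal smooth atlas. -/
abbrev smoothCharts : Set (OpenPartialHomeomorph M E3) :=
  IsManifold.maximalAtlas (𝓡 3) ∞ M

end Fields

section Coordinates

variable {M : Type*} [TopologicalSpace M] [ChartedSpace E3 M]

/-- `X` is smooth at every point of `V` (that is, in a neighbourhood of the set `V`). -/
def SmoothVecNear [IsManifold (𝓡 3) ∞ M] (X : VecField M) (V : Set M) : Prop :=
  ∀ x ∈ V, ContMDiffAt (𝓡 3) (𝓡 3).tangent ∞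
    (fun y => (⟨y, X y⟩ : TangentBundle (𝓡 3) M)) x

/-- `T` is smooth at every point of `V` (that is, in a neighbourhood of the set `V`). -/
def SmoothTensorNear [IsManifold (𝓡 3) ∞ M] (T : CovTensor2 M) (V : Set M) : Prop :=
  ∀ x ∈ V, ContMDiffAt (𝓡 3) ((𝓡 3).prod 𝓘(ℝ, E3 →L[ℝ] E3 →L[ℝ] ℝ)) ∞
    (fun y => TotalSpace.mk' (E3 →L[ℝ] E3 →L[ℝ] ℝ)
      (E := fun y : M => TangentSpace (𝓡 3) y →L[ℝ] TangentSpace (𝓡 3) y →L[ℝ] ℝ) y (T y)) x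

/-- The coordinate vector field `∂_i` of the coordinate system `e`, at the point with
coordinates `u`. -/
def coordVec (e : OpenPartialHomeomorph M E3) (i : Fin 3) (u : E3) :
    TangentSpace (𝓡 3) (e.symm u) :=
  mfderiv 𝓘(ℝ, E3) (𝓡 3) e.symm u (EuclideanSpace.single i (1 : ℝ) : E3)

/-- The components `v^i` of a tangent vector `v` at `x` in the coordinate system `e`. -/
def vecComp (e : OpenPartialHomeomorph M E3) (x : M) (v : TangentSpace (𝓡 3) x) : E3 :=
  mfderiv (𝓡 3) 𝓘(ℝ, E3) e x v

/-- The components `X^i` of a vector field as functions of the coordinates `u`. -/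
def vecCoord (X : VecField M) (e : OpenPartialHomeomorph M E3) (i : Fin 3) (u : E3) : ℝ :=
  vecComp e (e.symm u) (X (e.symm u)) i

/-- The components `T_{ij}` of a covariant 2-tensor as functions of the coordinates `u`. -/
def tensorCoord (T : CovTensor2 M) (e : OpenPartialHomeomorph M E3) (i j : Fin 3) (u : E3) : ℝ :=
  T (e.symm u) (coordVec e i u) (coordVec e j u)

/-- The partial derivative `∂f/∂u^i`. -/
def partialDeriv (i : Fin 3) (f : E3 → ℝ) (u : E3) : ℝ :=
  fderiv ℝ f u (EuclideanSpace.single i (1 : ℝ))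

variable [IsManifold (𝓡 3) ∞ M] (g : Metric3 M)

/-- The components `γ_{ij}` of the metric. -/
def metricCoord (e : OpenPartialHomeomorph M E3) (i j : Fin 3) (u : E3) : ℝ :=
  tensorCoord g.inner e i j u

/-- The components `γ^{ij}` of the inverse metric. -/
def invMetricCoord (e : OpenPartialHomeomorph M E3) (i j : Fin 3) (u : E3) : ℝ :=
  ((Matrix.of fun a b => metricCoord g e a b u)⁻¹ : Matrix (Fin 3) (Fin 3) ℝ) i j

/-- The Christoffel symbols `Γ^k_{ij}` of the Levi-Civita connection of the metric. -/
def christoffel (e : OpenPartialHomeomorph M E3) (k i j : Fin 3) (u : E3) : ℝ :=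
  (1 / 2) * ∑ l, invMetricCoord g e k l u *
    (partialDeriv i (metricCoord g e j l) u + partialDeriv j (metricCoord g e i l) u
      - partialDeriv l (metricCoord g e i j) u)

/-- The covariant derivative `T_{ij|k} = ∂_k T_{ij} - Γ^l_{ki} T_{lj} - Γ^l_{kj} T_{il}`. -/
def covDerivCoord (T : CovTensor2 M) (e : OpenPartialHomeomorph M E3) (i j k : Fin 3) (u : E3) :
    ℝ :=
  partialDeriv k (tensorCoord T e i j) u
    - ∑ l, christoffel g e l k i u * tensorCoord T e l j u
    - ∑ l, christoffel g e l k j u * tensorCoord T e i l u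

/-- The covariant divergence `T^i_{j|i} = γ^{ik} T_{ij|k}`. -/
def divCoord (T : CovTensor2 M) (e : OpenPartialHomeomorph M E3) (j : Fin 3) (u : E3) : ℝ :=
  ∑ i, ∑ k, invMetricCoord g e i k u * covDerivCoord g T e i j k u

/-- The Lie derivative of the metric,
`(L_X γ)_{ij} = X^k ∂_k γ_{ij} + γ_{kj} ∂_i X^k + γ_{ik} ∂_j X^k`. -/
def lieMetricCoord (X : VecField M) (e : OpenPartialHomeomorph M E3) (i j : Fin 3) (u : E3) : ℝ :=
  ∑ k, (vecCoord X e k u * partialDeriv k (metricCoord g e i j) u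
    + metricCoord g e k j u * partialDeriv i (vecCoord X e k) u
    + metricCoord g e i k u * partialDeriv j (vecCoord X e k) u)

/-- `X` satisfies the conformal Killing equation `L_X γ = λ γ` at the points of `V`,
for some function `λ`. -/
def IsConformalKillingOn (X : VecField M) (V : Set M) : Prop :=
  ∃ lam : M → ℝ, ∀ e ∈ smoothCharts M, ∀ x ∈ V ∩ e.source, ∀ i j : Fin 3,
    lieMetricCoord g X e i j (e x) = lam x * metricCoord g e i j (e x)

/-- `T_{ij} = T_{ji}` on `V`. -/
def IsSymmetricOn (T : CovTensor2 M) (V : Set M) : Prop :=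
  ∀ x ∈ V, ∀ v w : TangentSpace (𝓡 3) x, T x v w = T x w v

/-- `γ^{ij} T_{ij} = 0` on `V`. -/
def IsTracelessOn (T : CovTensor2 M) (V : Set M) : Prop :=
  ∀ e ∈ smoothCharts M, ∀ x ∈ V ∩ e.source,
    ∑ i, ∑ j, invMetricCoord g e i j (e x) * tensorCoord T e i j (e x) = 0

/-- `T^i_{j|i} = 0` on `V`. -/
def IsDivergenceFreeOn (T : CovTensor2 M) (V : Set M) : Prop :=
  ∀ e ∈ smoothCharts M, ∀ x ∈ V ∩ e.source, ∀ j : Fin 3, divCoord g T e j (e x) = 0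

end Coordinates

section Surfaces

variable {M : Type*} [TopologicalSpace M] [ChartedSpace E3 M]

/-- A slice chart of a subset `A`: a smooth coordinate system in which `A` is the coordinate
plane `u² = 0` (coordinates are numbered `0, 1, 2`). -/
def IsSliceChart (A : Set M) (e : OpenPartialHomeomorph M E3) : Prop :=
  e ∈ smoothCharts M ∧ ∀ x ∈ e.source, x ∈ A ↔ (e x) 2 = 0

/-- A boundary chart of a subset `W`: a smooth coordinate system in which `W` is the half-space
`u² ≤ 0`. -/
def IsBoundaryChart (W : Set M) (e : OpenPartialHomeomorph M E3) : Prop :=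
  e ∈ smoothCharts M ∧ ∀ x ∈ e.source, x ∈ W ↔ (e x) 2 ≤ 0

/-- Closed surfaces: compact embedded smooth two-dimensional submanifolds without boundary. -/
def IsClosedSurface (A : Set M) : Prop :=
  IsCompact A ∧ ∀ x ∈ A, ∃ e, IsSliceChart A e ∧ x ∈ e.source

/-- Compact three-dimensional regions with smooth (possibly empty) boundary. -/
def IsCompactRegion (W : Set M) : Prop :=
  IsCompact W ∧ ∀ x ∈ frontier W, ∃ e, IsBoundaryChart W e ∧ x ∈ e.source

/-- The plane `u² = 0` in `ℝ³`. -/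
def planePoint (w : EuclideanSpace ℝ (Fin 2)) : E3 := !₂[w 0, w 1, 0]

variable [IsManifold (𝓡 3) ∞ M] (g : Metric3 M)

/-- The area density `√(det (γ_{ab})_{a,b < 2})` that the metric induces on the plane `u² = 0`. -/
def areaDensity (e : OpenPartialHomeomorph M E3) (w : EuclideanSpace ℝ (Fin 2)) : ℝ :=
  √(metricCoord g e 0 0 (planePoint w) * metricCoord g e 1 1 (planePoint w)
    - metricCoord g e 0 1 (planePoint w) * metricCoord g e 1 0 (planePoint w))

/-- The Riemannian area of the part of a surface inside the domain of a slice chart `e`: the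
measure `√(det γ_{ab}) du⁰ du¹`, transported to `M`. -/
def patchArea [MeasurableSpace M] (e : OpenPartialHomeomorph M E3) : Measure M :=
  Measure.map (fun w => e.symm (planePoint w))
    ((volume.restrict {w | planePoint w ∈ e.target}).withDensity
      fun w => ENNReal.ofReal (areaDensity g e w))

/-- The Riemannian area measure of a surface `A`: the least measure that dominates the area of
every coordinate patch of `A`. Patches agree where they overlap, so it restricts to `patchArea`
on the domain of each slice chart. -/
def surfaceArea [MeasurableSpace M] (A : Set M) : Measure M :=
  ⨆ (e : OpenPartialHomeomorph M E3) (_ : IsSliceChart A e), patchArea g e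

/-- Closed surfaces with a continuous unit normal field `n` (an orientation of `dS_i`).
Only the values of `normal` on `carrier` matter. -/
structure OrientedClosedSurface where
  carrier : Set M
  isClosedSurface : IsClosedSurface carrier
  normal : VecField M
  continuousOn_normal :
    ContinuousOn (fun x => (⟨x, normal x⟩ : TangentBundle (𝓡 3) M)) carrier
  unit_normal : ∀ x ∈ carrier, g.inner x (normal x) (normal x) = 1
  /-- In a slice chart the tangent plane of the surface is spanned by `∂_0` and `∂_1`. -/
  orthogonal : ∀ e, IsSliceChart carrier e → ∀ u ∈ e.target, e.symm u ∈ carrier →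
    g.inner (e.symm u) (normal (e.symm u)) (coordVec e 0 u) = 0 ∧
    g.inner (e.symm u) (normal (e.symm u)) (coordVec e 1 u) = 0

variable {g}

/-- The flux density `T^i_j X^j n_i = T_{ij} n^i X^j` along the surface `S`. -/
def OrientedClosedSurface.fluxDensity (S : OrientedClosedSurface g) (T : CovTensor2 M)
    (X : VecField M) (x : M) : ℝ :=
  T x (S.normal x) (X x)

/-- The instantaneous charge `I(T, X) = ∫_S T^i_j X^j dS_i`, where `dS_i = n_i dA`. -/
def OrientedClosedSurface.charge [MeasurableSpace M] (S : OrientedClosedSurface g)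
    (T : CovTensor2 M) (X : VecField M) : ℝ :=
  ∫ x in S.carrier, S.fluxDensity T X x ∂(surfaceArea g S.carrier)

/-- `S₁` and `S₂` limit a volume in `V`: there is a compact region `W ⊆ V` with smooth boundary
whose boundary is the disjoint union of `S₁` and `S₂`, the normal of `S₂` pointing out of `W` and
the normal of `S₁` pointing into `W`. -/
def Cobound (V : Set M) (S₁ S₂ : OrientedClosedSurface g) : Prop :=
  ∃ W : Set M, IsCompactRegion W ∧ W ⊆ V ∧
    frontier W = S₁.carrier ∪ S₂.carrier ∧ Disjoint S₁.carrier S₂.carrier ∧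
    ∀ e, IsBoundaryChart W e →
      (∀ x ∈ e.source ∩ S₁.carrier, vecComp e x (S₁.normal x) 2 < 0) ∧
      (∀ x ∈ e.source ∩ S₂.carrier, 0 < vecComp e x (S₂.normal x) 2)

/-- The equivalence relation generated by limiting a volume in `V` (it also relates surfaces
that intersect each other, by means of intermediate surfaces). -/
def HomologousIn (V : Set M) : OrientedClosedSurface g → OrientedClosedSurface g → Prop :=
  Relation.EqvGen (Cobound V)

end Surfaces

end

/-!
The vector field `Y^i = T^i_j X^j` (`fluxField`) is divergence-free on `V`, since
`Y^i_{|i} = T^i_{j|i} X^j + ½ T^{ij} (L_X γ)_{ij} = ½ λ T^{ij} γ_{ij} = 0` for a symmetric,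
traceless and divergence-free `T` and a conformal Killing field `X` (`sum_divergence_eq`,
`sum_partialDeriv_fluxCoord`). The charge of a surface is the flux of `Y` through it, so the
divergence theorem on a region between two surfaces shows that their charges agree, and this passes
to the generated equivalence relation.

The divergence theorem on a compact region `W` is reduced by a partition of unity `ρ_α` to the one
on a half-space of `ℝ³` (`integral_halfSpace_divergence`). In a boundary chart that contains the
support of `ρ_α`, it equates the flux of `ρ_α Y` through `∂W` with `∫_W Y(ρ_α)`
(`setIntegral_derivAlong_of_isBoundaryChart`, `setIntegral_mul_fluxDensity_of_isSliceChart`); the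
sum over `α` of the fluxes is the difference of the two charges, and the sum of the volume integrals
vanishes because `∑ Y(ρ_α) = Y(1) = 0` (`Cobound.charge_eq`).

Adding up integrals over different charts requires that the volume measure of `M` and the area
measure of a surface restrict to the coordinate expressions in every chart. Both are suprema of
measures of parametrized patches; the patches agree on overlaps by the change of variables formula
(`IsPatch.patchMeasure_restrict_comm`), and a supremum of measures that agree on overlaps restricts
to each of them (`restrict_iSup_of_agree`). Integrability of the flux density follows because it is
continuous on the surface, which is compact and has finite area.
-/

noncomputable section

/-! ### Gluing measures and changing variables -/

/-- A supremum of measures `μ i`, each carried by an open set `U i` and agreeing on the overlaps,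
restricts to `μ i` on `U i`. Countably many of the `U i` cover the union, and the sum of the `μ i`
over the disjointed cover dominates every `μ j` and agrees with it on `U j`. -/
theorem restrict_iSup_of_agree {M ι : Type*} [TopologicalSpace M] [SecondCountableTopology M]
    [MeasurableSpace M] [BorelSpace M] (μ : ι → Measure M) (U : ι → Set M)
    (hU : ∀ i, IsOpen (U i)) (hμ : ∀ i, (μ i).restrict (U i) = μ i)
    (hagree : ∀ i j, (μ i).restrict (U j) = (μ j).restrict (U i)) (i : ι) :
    (⨆ j, μ j).restrict (U i) = μ i := by
  obtain ⟨T, hTc, hT⟩ := TopologicalSpace.isOpen_iUnion_countable U hU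
  obtain ⟨f, hf⟩ := (hTc.insert i).exists_eq_range (insert_nonempty i T)
  have hcov : ∀ j, U j ⊆ ⋃ k, U (f k) := by
    intro j x hx
    have hx' : x ∈ ⋃ j ∈ T, U j := hT ▸ mem_iUnion_of_mem j hx
    obtain ⟨t, ht, hxt⟩ := mem_iUnion₂.1 hx'
    obtain ⟨k, hk⟩ : t ∈ range f := hf ▸ mem_insert_of_mem i ht
    exact mem_iUnion_of_mem k (hk ▸ hxt)
  set D : ℕ → Set M := disjointed fun k => U (f k) with hD
  have hDm : ∀ k, MeasurableSet (D k) :=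
    fun k => MeasurableSet.disjointed (fun k => (hU (f k)).measurableSet) k
  have hDU : ∀ k, D k ⊆ U (f k) := fun k => disjointed_subset _ k
  let ν : Measure M := Measure.sum fun k => (μ (f k)).restrict (D k)
  have hν : ∀ j, ν.restrict (U j) = μ j := by
    intro j
    have h1 : ν.restrict (U j) = Measure.sum fun k => (μ j).restrict (D k) := by
      rw [Measure.restrict_sum _ (hU j).measurableSet]
      congr 1
      funext k
      rw [Measure.restrict_restrict (hU j).measurableSet, inter_comm,
        ← Measure.restrict_restrict (hDm k), hagree, Measure.restrict_restrict (hDm k),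
        inter_eq_left.2 (hDU k)]
    rw [h1, ← Measure.restrict_iUnion (disjoint_disjointed _) hDm, iUnion_disjointed,
      ← hμ j, Measure.restrict_restrict (MeasurableSet.iUnion fun k => (hU (f k)).measurableSet),
      inter_eq_right.2 (hcov j)]
  apply le_antisymm
  · calc (⨆ j, μ j).restrict (U i) ≤ ν.restrict (U i) :=
          Measure.restrict_mono le_rfl
            (iSup_le fun j => by rw [← hν j]; exact Measure.restrict_le_self)
      _ = μ i := hν i
  · calc μ i = (μ i).restrict (U i) := (hμ i).symm
      _ ≤ (⨆ j, μ j).restrict (U i) := Measure.restrict_mono le_rfl (le_iSup μ i)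

theorem integrableOn_of_continuousOn {M : Type*} [TopologicalSpace M] [T2Space M]
    [MeasurableSpace M] [BorelSpace M] {μ : Measure M} {K : Set M} {f : M → ℝ} (hK : IsCompact K)
    (hμ : μ K < ⊤) (hf : ContinuousOn f K) : IntegrableOn f K μ := by
  obtain ⟨C, hC⟩ := hK.exists_bound_of_continuousOn hf
  have hfin : IsFiniteMeasure (μ.restrict K) := ⟨by rwa [Measure.restrict_apply_univ]⟩
  exact Integrable.of_bound (hf.aestronglyMeasurable hK.measurableSet) C
    ((ae_restrict_iff' hK.measurableSet).2 (Filter.Eventually.of_forall hC))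

/-- Two measures pushed forward by parametrizations `ψ` and `ψ'` agree on the overlap of the
parametrized pieces if the densities are related by the Jacobian of the transition map `φ`. -/
theorem map_withDensity_restrict_eq {M F : Type*} [MeasurableSpace M] [NormedAddCommGroup F]
    [NormedSpace ℝ F] [FiniteDimensional ℝ F] [MeasurableSpace F] [BorelSpace F]
    (μ : Measure F) [μ.IsAddHaarMeasure]
    {O O' : Set F} {U U' : Set M} {ψ ψ' : F → M} {d d' : F → ENNReal}
    (hO : MeasurableSet O) (hO' : MeasurableSet O') (hU : MeasurableSet U) (hU' : MeasurableSet U')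
    (hψ : AEMeasurable ψ ((μ.restrict O).withDensity d))
    (hψ' : AEMeasurable ψ' ((μ.restrict O').withDensity d'))
    (hmeas : ∀ B, MeasurableSet B → MeasurableSet (O ∩ ψ ⁻¹' B))
    (hmeas' : ∀ B, MeasurableSet B → MeasurableSet (O' ∩ ψ' ⁻¹' B))
    (hψU : MapsTo ψ O U)
    (hinj : InjOn ψ O)
    (φ : F → F) (φ' : F → F →L[ℝ] F)
    (hφ : ∀ w ∈ O, ψ w ∈ U' → φ w ∈ O' ∧ ψ' (φ w) = ψ w ∧ HasFDerivAt φ (φ' w) w ∧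
      d w = ENNReal.ofReal |(φ' w).det| * d' (φ w))
    (hsurj : ∀ w' ∈ O', ψ' w' ∈ U → ∃ w ∈ O, ψ w ∈ U' ∧ φ w = w') :
    (Measure.map ψ ((μ.restrict O).withDensity d)).restrict U' =
      (Measure.map ψ' ((μ.restrict O').withDensity d')).restrict U := by
  ext B hB
  rw [Measure.restrict_apply hB, Measure.restrict_apply hB,
    Measure.map_apply_of_aemeasurable hψ (hB.inter hU'),
    Measure.map_apply_of_aemeasurable hψ' (hB.inter hU)]
  have key : ∀ (O : Set F) (ψ : F → M) (d : F → ENNReal) (C : Set M), MeasurableSet O →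
      MeasurableSet (O ∩ ψ ⁻¹' C) →
      ((μ.restrict O).withDensity d) (ψ ⁻¹' C) = ∫⁻ w in O ∩ ψ ⁻¹' C, d w ∂μ := by
    intro O ψ d C hO hC
    have h0 : ((μ.restrict O).withDensity d) Oᶜ = 0 := by
      rw [withDensity_apply _ hO.compl, Measure.restrict_restrict hO.compl]; simp
    have h1 : ((μ.restrict O).withDensity d) (ψ ⁻¹' C) =
        ((μ.restrict O).withDensity d) (O ∩ ψ ⁻¹' C) := by
      refine le_antisymm ?_ (measure_mono inter_subset_right)
      calc _ ≤ ((μ.restrict O).withDensity d) ((O ∩ ψ ⁻¹' C) ∪ Oᶜ) := measure_mono (by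
            intro w hw; by_cases h : w ∈ O
            · exact Or.inl ⟨h, hw⟩
            · exact Or.inr h)
        _ ≤ _ := measure_union_le _ _
        _ = _ := by rw [h0, add_zero]
    rw [h1, withDensity_apply _ hC, Measure.restrict_restrict hC,
      inter_eq_left.2 inter_subset_left]
  rw [key O ψ d _ hO (hmeas _ (hB.inter hU')), key O' ψ' d' _ hO' (hmeas' _ (hB.inter hU))]
  have himg : O' ∩ ψ' ⁻¹' (B ∩ U) = φ '' (O ∩ ψ ⁻¹' (B ∩ U')) := by
    ext w'
    constructor
    · rintro ⟨hw', hB', hU1⟩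
      obtain ⟨w, hw, hwU, rfl⟩ := hsurj w' hw' hU1
      refine ⟨w, ⟨hw, ?_, hwU⟩, rfl⟩
      rw [← (hφ w hw hwU).2.1]; exact hB'
    · rintro ⟨w, ⟨hw, hwB, hwU⟩, rfl⟩
      obtain ⟨h1, h2, -⟩ := hφ w hw hwU
      refine ⟨h1, ?_, ?_⟩
      · rw [h2]; exact hwB
      · rw [h2]; exact hψU hw
  have hinjφ : InjOn φ (O ∩ ψ ⁻¹' (B ∩ U')) := by
    rintro w ⟨hw, -, hwU⟩ z ⟨hz, -, hzU⟩ h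
    apply hinj hw hz
    rw [← (hφ w hw hwU).2.1, ← (hφ z hz hzU).2.1, h]
  rw [himg, lintegral_image_eq_lintegral_abs_det_fderiv_mul μ (hmeas _ (hB.inter hU'))
    (fun w hw => (hφ w hw.1 hw.2.2).2.2.1.hasFDerivWithinAt) hinjφ]
  exact setLIntegral_congr_fun (hmeas _ (hB.inter hU')) (fun w hw => (hφ w hw.1 hw.2.2).2.2.2)

/-! ### The divergence theorem on a half-space -/

/-- The divergence theorem on the half-space `u² ≤ 0` for compactly supported fields. -/
theorem integral_halfSpace_divergence (G : Fin 3 → E3 → ℝ) (hG : ∀ i, ContDiff ℝ 1 (G i))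
    (hc : ∀ i, HasCompactSupport (G i)) :
    ∫ u in {u : E3 | u 2 ≤ 0}, ∑ i, partialDeriv i (G i) u = ∫ w, G 2 (planePoint w) := by
  have hd : ∀ i, Differentiable ℝ (G i) := fun i => (hG i).differentiable (by simp)
  have hcont : ∀ i, Continuous (partialDeriv i (G i)) := fun i =>
    ((hG i).continuous_fderiv (by simp)).clm_apply continuous_const
  obtain ⟨R, hR⟩ : ∃ R : ℝ, 0 < R ∧ ∀ i, ∀ u : E3, (∃ j, R ≤ |u j|) → G i u = 0 := by
    have hK : IsCompact (⋃ i, tsupport (G i)) := isCompact_iUnion fun i => hc i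
    obtain ⟨R, hR0, hR⟩ := hK.isBounded.exists_pos_norm_lt
    refine ⟨R, hR0, fun i u ⟨j, hj⟩ => ?_⟩
    by_contra h
    have h1 := hR u (mem_iUnion_of_mem i (subset_tsupport _ h))
    have h2 := PiLp.norm_apply_le u j
    rw [Real.norm_eq_abs] at h2
    linarith
  obtain ⟨hR0, hR⟩ := hR
  have hdz : ∀ i, ∀ u : E3, (∃ j, R < |u j|) → partialDeriv i (G i) u = 0 := by
    rintro i u ⟨j, hj⟩
    have : G i =ᶠ[nhds u] fun _ => 0 := by
      have : {v : E3 | R < |v j|} ∈ nhds u :=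
        (isOpen_lt continuous_const (by fun_prop)).mem_nhds hj
      filter_upwards [this] with v hv
      exact hR i v ⟨j, le_of_lt hv⟩
    rw [partialDeriv, this.fderiv_eq]; simp
  -- All faces of the box `[-R, R]² × [-R, 0]` other than `u² = 0` lie off the supports.
  let eL : E3 ≃L[ℝ] (Fin 3 → ℝ) := EuclideanSpace.equiv (Fin 3) ℝ
  let a : Fin 3 → ℝ := fun _ => -R
  let b : Fin 3 → ℝ := fun i => if i = 2 then 0 else R
  have hle : a ≤ b := by
    intro i; simp only [a, b]; split_ifs <;> linarith
  have hD := integral_divergence_of_hasFDerivAt_off_countable' a b hle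
    (fun i x => G i (eL.symm x))
    (fun i x => (fderiv ℝ (G i) (eL.symm x)).comp (eL.symm : (Fin 3 → ℝ) →L[ℝ] E3)) ∅
    countable_empty
    (fun i => ((hd i).continuous.comp eL.symm.continuous).continuousOn)
    (fun x _ i => (hd i _).hasFDerivAt.comp x eL.symm.hasFDerivAt)
    (by
      apply Continuous.integrableOn_Icc
      refine continuous_finsetSum _ fun i _ => ?_
      exact ((((hG i).continuous_fderiv (by simp)).comp eL.symm.continuous).clm_apply
        continuous_const))
  have hsingle : ∀ i : Fin 3, eL.symm (Pi.single i 1) = EuclideanSpace.single i (1 : ℝ) := by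
    intro i; ext j; simp [eL, EuclideanSpace.equiv]
  have hmp := PiLp.volume_preserving_toLp (Fin 3)
  have hmp2 := PiLp.volume_preserving_toLp (Fin 2)
  have hme : MeasurableEmbedding (WithLp.toLp 2 : (Fin 3 → ℝ) → E3) :=
    (MeasurableEquiv.toLp 2 (Fin 3 → ℝ)).measurableEmbedding
  have hme2 : MeasurableEmbedding (WithLp.toLp 2 : (Fin 2 → ℝ) → EuclideanSpace ℝ (Fin 2)) :=
    (MeasurableEquiv.toLp 2 (Fin 2 → ℝ)).measurableEmbedding
  have hL : ∫ u in {u : E3 | u 2 ≤ 0}, ∑ i, partialDeriv i (G i) u =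
      ∫ x in Icc a b, ∑ i, partialDeriv i (G i) (eL.symm x) := by
    rw [← hmp.setIntegral_preimage_emb hme]
    have hsub : Icc a b ⊆ WithLp.toLp 2 ⁻¹' {u : E3 | u 2 ≤ 0} := by
      intro x hx; simpa [b] using hx.2 2
    refine (setIntegral_eq_of_subset_of_forall_sdiff_eq_zero
      ((measurableSet_le (by fun_prop) measurable_const :
        MeasurableSet {u : E3 | u 2 ≤ 0}).preimage hme.measurable) hsub ?_)
    rintro x ⟨hx2, hx⟩
    refine Finset.sum_eq_zero fun i _ => hdz i _ ?_
    by_contra! hno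
    apply hx
    refine ⟨fun j => (abs_le.1 (hno j)).1, fun j => ?_⟩
    simp only [b]
    split_ifs with h
    · subst h; exact hx2
    · exact (abs_le.1 (hno j)).2
  have hRt : ∫ w, G 2 (planePoint w) =
      ∫ x in Icc (a ∘ Fin.succAbove 2) (b ∘ Fin.succAbove 2),
        G 2 (eL.symm (Fin.insertNth 2 (b 2) x)) := by
    have hpl : ∀ x : Fin 2 → ℝ, planePoint (WithLp.toLp 2 x) =
        eL.symm (Fin.insertNth (α := fun _ => ℝ) 2 (b 2) x) := by
      intro x; ext j; fin_cases j
      · simp [planePoint, eL, EuclideanSpace.equiv, Fin.insertNth, Fin.succAboveCases]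
      · simp [planePoint, eL, EuclideanSpace.equiv, Fin.insertNth, Fin.succAboveCases]
      · simp [planePoint, eL, EuclideanSpace.equiv, b]
    rw [← hmp2.integral_comp hme2]
    simp only [hpl]
    rw [← integral_indicator measurableSet_Icc]
    congr 1
    ext x
    by_cases hx : x ∈ Icc (a ∘ Fin.succAbove 2) (b ∘ Fin.succAbove 2)
    · rw [indicator_of_mem hx]
    · rw [indicator_of_notMem hx]
      apply hR
      by_contra! hno
      apply hx
      refine ⟨fun j => ?_, fun j => ?_⟩
      all_goals
        have := hno (Fin.succAbove 2 j)
        have h2 : (eL.symm (Fin.insertNth (α := fun _ => ℝ) 2 (b 2) x)).ofLp (Fin.succAbove 2 j)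
          = x j := by
          change Fin.insertNth (α := fun _ => ℝ) 2 (b 2) x (Fin.succAbove 2 j) = x j
          exact Fin.insertNth_apply_succAbove 2 _ _ j
        rw [h2] at this
        have h3 := abs_lt.1 this
        simp only [Function.comp, a, b, Fin.succAbove_ne, if_false]
        linarith
  rw [hL, hRt]
  simp only [ContinuousLinearMap.comp_apply] at hD
  have hz : ∀ (i : Fin 3) (c : ℝ), R ≤ |c| → ∫ x in Icc (a ∘ Fin.succAbove i) (b ∘ Fin.succAbove i),
        G i (eL.symm (Fin.insertNth i c x)) = 0 := by
    intro i c hcR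
    apply integral_eq_zero_of_ae
    refine Filter.Eventually.of_forall fun x => hR i _ ⟨i, ?_⟩
    have : (eL.symm (Fin.insertNth (α := fun _ => ℝ) i c x)).ofLp i = c := by
      change Fin.insertNth (α := fun _ => ℝ) i c x i = c
      exact Fin.insertNth_apply_same i _ _
    rw [this]; exact hcR
  have ha : ∀ i, R ≤ |a i| := fun i => by simp [a, le_abs_self]
  rw [Fin.sum_univ_three, hz 0 (b 0) (by simp [b, le_abs_self]),
    hz 1 (b 1) (by simp [b, le_abs_self]), hz 0 _ (ha 0), hz 1 _ (ha 1), hz 2 _ (ha 2)] at hD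
  simp only [sub_zero, zero_add] at hD
  rw [← hD]
  refine setIntegral_congr_fun measurableSet_Icc fun x _ => ?_
  refine Finset.sum_congr rfl fun i _ => ?_
  rw [partialDeriv]
  exact congrArg _ (hsingle i).symm

theorem euclidean_eq_sum_single {n : ℕ} (v : EuclideanSpace ℝ (Fin n)) :
    v = ∑ i, v i • EuclideanSpace.single i (1 : ℝ) := by
  ext j
  simp [Finset.sum_apply, Pi.single_apply]

/-! ### Tensor components in coordinate systems -/

section Charts

variable {M : Type*} [TopologicalSpace M] [ChartedSpace E3 M]
  {e : OpenPartialHomeomorph M E3} {u : E3}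

theorem mdifferentiable_of_mem_smoothCharts (he : e ∈ smoothCharts M) :
    e.MDifferentiable (𝓡 3) (𝓡 3) :=
  ⟨(contMDiffOn_of_mem_maximalAtlas he).mdifferentiableOn (by simp),
    (contMDiffOn_symm_of_mem_maximalAtlas he).mdifferentiableOn (by simp)⟩

theorem contMDiffAt_symm (he : e ∈ smoothCharts M) (hu : u ∈ e.target) :
    ContMDiffAt 𝓘(ℝ, E3) (𝓡 3) ∞ e.symm u :=
  contMDiffAt_symm_of_mem_maximalAtlas he hu

theorem vecComp_mfderiv_symm (he : e ∈ smoothCharts M) (hu : u ∈ e.target) (v : E3) :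
    vecComp e (e.symm u) (mfderiv 𝓘(ℝ, E3) (𝓡 3) e.symm u v) = v := by
  have h := (mdifferentiable_of_mem_smoothCharts he).comp_symm_deriv hu
  exact congrArg (fun L : E3 →L[ℝ] E3 => L v) h

theorem mfderiv_symm_vecComp (he : e ∈ smoothCharts M) (hu : u ∈ e.target)
    (v : TangentSpace (𝓡 3) (e.symm u)) :
    mfderiv 𝓘(ℝ, E3) (𝓡 3) e.symm u (vecComp e (e.symm u) v) = v := by
  have h := (mdifferentiable_of_mem_smoothCharts he).symm_comp_deriv (e.map_target hu)
  rw [e.right_inv hu] at h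
  exact congrArg
    (fun L : TangentSpace (𝓡 3) (e.symm u) →L[ℝ] TangentSpace (𝓡 3) (e.symm u) => L v) h

theorem mfderiv_symm_eq_sum (e : OpenPartialHomeomorph M E3) (u v : E3) :
    mfderiv 𝓘(ℝ, E3) (𝓡 3) e.symm u v = ∑ i, v i • coordVec e i u := by
  let L : E3 →L[ℝ] TangentSpace (𝓡 3) (e.symm u) := mfderiv 𝓘(ℝ, E3) (𝓡 3) e.symm u
  change L v = ∑ i, v i • L (EuclideanSpace.single i (1 : ℝ))
  conv_lhs => rw [euclidean_eq_sum_single v]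
  rw [map_sum]
  exact Finset.sum_congr rfl fun i _ => map_smul _ _ _

theorem eq_sum_coordVec (he : e ∈ smoothCharts M) (hu : u ∈ e.target)
    (v : TangentSpace (𝓡 3) (e.symm u)) :
    v = ∑ i, vecComp e (e.symm u) v i • coordVec e i u := by
  rw [← mfderiv_symm_eq_sum, mfderiv_symm_vecComp he hu]

theorem apply_vec_eq_sum (T : CovTensor2 M) (he : e ∈ smoothCharts M) (hu : u ∈ e.target)
    (w v : TangentSpace (𝓡 3) (e.symm u)) :
    T (e.symm u) w v = ∑ k, T (e.symm u) w (coordVec e k u) * vecComp e (e.symm u) v k := by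
  conv_lhs => rw [eq_sum_coordVec he hu v]
  simp only [map_sum, map_smul, smul_eq_mul]
  exact Finset.sum_congr rfl fun k _ => mul_comm _ _

variable [IsManifold (𝓡 3) ∞ M]

theorem contMDiffAt_coordVec (he : e ∈ smoothCharts M) (hu : u ∈ e.target) (i : Fin 3) :
    ContMDiffAt 𝓘(ℝ, E3) (𝓡 3).tangent ∞
      (fun u => (⟨e.symm u, coordVec e i u⟩ : TangentBundle (𝓡 3) M)) u := by
  have h1 := (contMDiffOn_symm_of_mem_maximalAtlas he).contMDiffOn_tangentMapWithin
    (m := ∞) (by simp) e.open_target.uniqueMDiffOn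
  have h2 : ContMDiffAt 𝓘(ℝ, E3) (𝓘(ℝ, E3)).tangent ∞
      (fun u : E3 => (⟨u, EuclideanSpace.single i (1 : ℝ)⟩ : TangentBundle 𝓘(ℝ, E3) E3)) u :=
    contMDiffAt_vectorSpace_iff_contDiffAt.2 contDiffAt_const
  have h3 := (h1.contMDiffAt
    (x := (⟨u, EuclideanSpace.single i (1 : ℝ)⟩ : TangentBundle 𝓘(ℝ, E3) E3))
    ((e.open_target.preimage (FiberBundle.continuous_proj E3 _)).mem_nhds hu)).comp u h2
  refine h3.congr_of_eventuallyEq ?_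
  filter_upwards [e.open_target.mem_nhds hu] with w hw
  simp only [Function.comp, tangentMapWithin]
  rw [mfderivWithin_of_isOpen e.open_target hw]
  rfl

theorem contDiffAt_tensorCoord {n : WithTop ℕ∞} (hn : n ≤ ∞) (he : e ∈ smoothCharts M)
    (hu : u ∈ e.target)
    {T : CovTensor2 M} (hT : ContMDiffAt (𝓡 3) ((𝓡 3).prod 𝓘(ℝ, E3 →L[ℝ] E3 →L[ℝ] ℝ)) n
    (fun y => TotalSpace.mk' (E3 →L[ℝ] E3 →L[ℝ] ℝ)
      (E := fun y : M => TangentSpace (𝓡 3) y →L[ℝ] TangentSpace (𝓡 3) y →L[ℝ] ℝ) y (T y))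
      (e.symm u)) (i j : Fin 3) :
    ContDiffAt ℝ n (tensorCoord T e i j) u := by
  have h := ContMDiffAt.clm_bundle_apply₂ (F₁ := E3) (F₂ := E3) (F₃ := ℝ)
    (E₁ := fun x : M => TangentSpace (𝓡 3) x) (E₂ := fun x : M => TangentSpace (𝓡 3) x)
    (E₃ := fun _ : M => ℝ) (b := e.symm) (ψ := fun u => T (e.symm u))
    (v := coordVec e i) (w := coordVec e j)
    (hT.comp u ((contMDiffAt_symm he hu).of_le hn))
    ((contMDiffAt_coordVec he hu i).of_le hn) ((contMDiffAt_coordVec he hu j).of_le hn)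
  rw [contMDiffAt_totalSpace] at h
  exact h.2.contDiffAt

theorem contDiffAt_vecCoord {n : WithTop ℕ∞} (hn : n ≤ ∞) (he : e ∈ smoothCharts M)
    (hu : u ∈ e.target)
    {X : VecField M} (hX : ContMDiffAt (𝓡 3) (𝓡 3).tangent n
    (fun y => (⟨y, X y⟩ : TangentBundle (𝓡 3) M)) (e.symm u)) (i : Fin 3) :
    ContDiffAt ℝ n (vecCoord X e i) u := by
  have h1 := (contMDiffOn_of_mem_maximalAtlas he).contMDiffOn_tangentMapWithin
    (m := ∞) (by simp) e.open_source.uniqueMDiffOn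
  have h2 : ContMDiffAt 𝓘(ℝ, E3) (𝓡 3).tangent n
      (fun u => (⟨e.symm u, X (e.symm u)⟩ : TangentBundle (𝓡 3) M)) u :=
    hX.comp u ((contMDiffAt_symm he hu).of_le hn)
  have h3 := ((h1.contMDiffAt (x := (⟨e.symm u, X (e.symm u)⟩ : TangentBundle (𝓡 3) M))
    ((e.open_source.preimage (FiberBundle.continuous_proj E3 _)).mem_nhds
      (e.map_target hu))).of_le hn).comp u h2
  have h4 := ((contMDiff_snd_tangentBundle_modelSpace (n := n) E3 𝓘(ℝ, E3)).contMDiffAt.comp u h3)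
  have h5 : ContDiffAt ℝ n (fun u => vecComp e (e.symm u) (X (e.symm u))) u := by
    refine h4.contDiffAt.congr_of_eventuallyEq ?_
    filter_upwards [e.open_target.mem_nhds hu] with w hw
    simp only [Function.comp, tangentMapWithin]
    rw [mfderivWithin_of_isOpen e.open_source (e.map_target hw)]
    rfl
  exact (contDiffAt_piLp 2).1 h5 i

end Charts

section Metric

variable {M : Type*} [TopologicalSpace M] [ChartedSpace E3 M] [IsManifold (𝓡 3) ∞ M]
  {e : OpenPartialHomeomorph M E3} {u : E3} (g : Metric3 M)

/-- The Gram matrix `(γ_{ij})` of the coordinate vector fields. -/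
def metricMatrix (e : OpenPartialHomeomorph M E3) (u : E3) : Matrix (Fin 3) (Fin 3) ℝ :=
  Matrix.of fun i j => metricCoord g e i j u

theorem metricCoord_symm (e : OpenPartialHomeomorph M E3) (u : E3) (i j : Fin 3) :
    metricCoord g e i j u = metricCoord g e j i u := g.symm _ _ _

theorem contDiffAt_metricCoord (he : e ∈ smoothCharts M) (hu : u ∈ e.target) (i j : Fin 3) :
    ContDiffAt ℝ ∞ (metricCoord g e i j) u :=
  contDiffAt_tensorCoord le_rfl he hu g.contMDiff.contMDiffAt i j

theorem posDef_metricMatrix (he : e ∈ smoothCharts M) (hu : u ∈ e.target) :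
    (metricMatrix g e u).PosDef := by
  refine Matrix.PosDef.of_dotProduct_mulVec_pos ?_ fun x hx => ?_
  · ext i j
    simp [metricMatrix, metricCoord_symm g e u i j]
  · have h1 : star x ⬝ᵥ (metricMatrix g e u).mulVec x =
        g.inner (e.symm u) (mfderiv 𝓘(ℝ, E3) (𝓡 3) e.symm u (WithLp.toLp 2 x))
          (mfderiv 𝓘(ℝ, E3) (𝓡 3) e.symm u (WithLp.toLp 2 x)) := by
      rw [mfderiv_symm_eq_sum]
      simp only [map_sum, map_smul, sum_apply, smul_apply,
        smul_eq_mul, dotProduct, Matrix.mulVec, metricMatrix, Matrix.of_apply, metricCoord,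
        tensorCoord, Finset.mul_sum, star_trivial]
      rw [Finset.sum_comm]
      exact Finset.sum_congr rfl fun i _ => Finset.sum_congr rfl fun j _ => by ring
    rw [h1]
    apply g.pos
    intro h0
    have h2 := vecComp_mfderiv_symm he hu (WithLp.toLp 2 x)
    rw [h0] at h2
    apply hx
    have h3 : (0 : E3) = WithLp.toLp 2 x := by rw [← h2]; exact (map_zero _).symm
    funext i
    exact (congrArg (fun v : E3 => v i) h3).symm

theorem det_metricMatrix_pos (he : e ∈ smoothCharts M) (hu : u ∈ e.target) :
    0 < (metricMatrix g e u).det := (posDef_metricMatrix g he hu).det_pos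

theorem contDiffAt_matrix_det {n : WithTop ℕ∞} {E m : Type*} [NormedAddCommGroup E]
    [NormedSpace ℝ E] [Fintype m] [DecidableEq m] {A : E → Matrix m m ℝ} {u : E}
    (hA : ∀ i j, ContDiffAt ℝ n (fun v => A v i j) u) : ContDiffAt ℝ n (fun v => (A v).det) u := by
  simp only [Matrix.det_apply]
  exact ContDiffAt.sum fun σ _ => (contDiffAt_prod fun i _ => hA _ _).const_smul _

theorem contDiffAt_matrix_inv {n : WithTop ℕ∞} {E m : Type*} [NormedAddCommGroup E]
    [NormedSpace ℝ E] [Fintype m] [DecidableEq m] {A : E → Matrix m m ℝ} {u : E}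
    (hA : ∀ i j, ContDiffAt ℝ n (fun v => A v i j) u) (hdet : (A u).det ≠ 0) (i j : m) :
    ContDiffAt ℝ n (fun v => (A v)⁻¹ i j) u := by
  simp only [Matrix.inv_def, Ring.inverse_eq_inv', Matrix.smul_apply, smul_eq_mul,
    Matrix.adjugate_apply]
  refine ((contDiffAt_matrix_det hA).inv hdet).mul (contDiffAt_matrix_det fun a b => ?_)
  by_cases h : a = j
  · subst h
    simp only [Matrix.updateRow_self]
    exact contDiffAt_const
  · simp only [Matrix.updateRow_ne h]
    exact hA a b

theorem contDiffAt_det_metricMatrix (he : e ∈ smoothCharts M) (hu : u ∈ e.target) :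
    ContDiffAt ℝ ∞ (fun v => (metricMatrix g e v).det) u :=
  contDiffAt_matrix_det fun i j => contDiffAt_metricCoord g he hu i j

theorem contDiffAt_invMetricCoord (he : e ∈ smoothCharts M) (hu : u ∈ e.target) (i j : Fin 3) :
    ContDiffAt ℝ ∞ (invMetricCoord g e i j) u :=
  contDiffAt_matrix_inv (A := metricMatrix g e) (fun i j => contDiffAt_metricCoord g he hu i j)
    (det_metricMatrix_pos g he hu).ne' i j

theorem invMetricCoord_symm (e : OpenPartialHomeomorph M E3) (u : E3) (i j : Fin 3) :
    invMetricCoord g e i j u = invMetricCoord g e j i u := by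
  have h : (metricMatrix g e u).transpose = metricMatrix g e u := by
    ext i j; exact metricCoord_symm g e u j i
  change (metricMatrix g e u)⁻¹ i j = (metricMatrix g e u)⁻¹ j i
  conv_rhs => rw [← h, ← Matrix.transpose_nonsing_inv]
  rfl

theorem sum_invMetricCoord_mul_metricCoord (he : e ∈ smoothCharts M) (hu : u ∈ e.target)
    (i j : Fin 3) :
    ∑ k, invMetricCoord g e i k u * metricCoord g e k j u = if i = j then 1 else 0 := by
  have h := Matrix.nonsing_inv_mul (metricMatrix g e u)
    (det_metricMatrix_pos g he hu).ne'.isUnit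
  have := congrFun (congrFun h i) j
  rw [Matrix.one_apply, Matrix.mul_apply] at this
  exact this

/-- Every covector is the metric dual of a vector. -/
theorem exists_sharp (x : M) (η : TangentSpace (𝓡 3) x →ₗ[ℝ] ℝ) :
    ∃ y : TangentSpace (𝓡 3) x, ∀ v, g.inner x y v = η v := by
  let B : TangentSpace (𝓡 3) x →ₗ[ℝ] Module.Dual ℝ (TangentSpace (𝓡 3) x) :=
    { toFun := fun y => (g.inner x y).toLinearMap
      map_add' := fun y z => by ext v; simp
      map_smul' := fun c y => by ext v; simp }
  have hfin : FiniteDimensional ℝ (TangentSpace (𝓡 3) x) :=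
    inferInstanceAs (FiniteDimensional ℝ E3)
  have hinj : Function.Injective B := by
    rw [← LinearMap.ker_eq_bot, LinearMap.ker_eq_bot']
    intro y hy
    by_contra h
    have h1 := g.pos x y h
    have h2 : g.inner x y y = 0 := congrArg (fun L : TangentSpace (𝓡 3) x →ₗ[ℝ] ℝ => L y) hy
    linarith
  have hsurj := (LinearMap.injective_iff_surjective_of_finrank_eq_finrank
    (Subspace.dual_finrank_eq (K := ℝ) (V := TangentSpace (𝓡 3) x)).symm).1 hinj
  obtain ⟨y, hy⟩ := hsurj η
  exact ⟨y, fun v => congrArg (fun L : TangentSpace (𝓡 3) x →ₗ[ℝ] ℝ => L v) hy⟩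

/-- The vector field `Y^i = T^i_j X^j`, that is, `γ_{ij} Y^i v^j = T_{ij} v^i X^j` for all `v`. -/
def fluxField (T : CovTensor2 M) (X : VecField M) (x : M) : TangentSpace (𝓡 3) x :=
  (exists_sharp g x
    { toFun := fun v => T x v (X x)
      map_add' := fun v w => by simp
      map_smul' := fun c v => by simp }).choose

theorem inner_fluxField (T : CovTensor2 M) (X : VecField M) (x : M) (v : TangentSpace (𝓡 3) x) :
    g.inner x (fluxField g T X x) v = T x v (X x) :=
  (exists_sharp g x _).choose_spec v

theorem vecComp_eq_sum_invMetricCoord (he : e ∈ smoothCharts M) (hu : u ∈ e.target)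
    (y : TangentSpace (𝓡 3) (e.symm u)) (i : Fin 3) :
    vecComp e (e.symm u) y i =
      ∑ j, invMetricCoord g e i j u * g.inner (e.symm u) y (coordVec e j u) := by
  have h : ∀ j, g.inner (e.symm u) y (coordVec e j u) =
      ∑ k, metricCoord g e j k u * vecComp e (e.symm u) y k := by
    intro j
    rw [g.symm, apply_vec_eq_sum g.inner he hu]
    rfl
  simp only [h, Finset.mul_sum]
  rw [Finset.sum_comm]
  simp only [← mul_assoc, ← Finset.sum_mul, sum_invMetricCoord_mul_metricCoord g he hu]
  simp

theorem vecCoord_fluxField (T : CovTensor2 M) (X : VecField M) (he : e ∈ smoothCharts M)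
    (hu : u ∈ e.target) (i : Fin 3) :
    vecCoord (fluxField g T X) e i u =
      ∑ j, invMetricCoord g e i j u * ∑ k, tensorCoord T e j k u * vecCoord X e k u := by
  rw [vecCoord, vecComp_eq_sum_invMetricCoord g he hu]
  refine Finset.sum_congr rfl fun j _ => ?_
  rw [inner_fluxField, apply_vec_eq_sum T he hu]
  rfl

end Metric

/-! ### The divergence of the flux field -/

section PartialDeriv
variable {u : E3} {c : Fin 3} {a b : E3 → ℝ}

theorem partialDeriv_mul (ha : DifferentiableAt ℝ a u) (hb : DifferentiableAt ℝ b u) :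
    partialDeriv c (fun v => a v * b v) u =
      partialDeriv c a u * b u + a u * partialDeriv c b u := by
  simp only [partialDeriv]
  rw [fderiv_fun_mul ha hb]
  simp
  ring

theorem partialDeriv_sum {ι : Type*} {s : Finset ι} {f : ι → E3 → ℝ}
    (hf : ∀ i ∈ s, DifferentiableAt ℝ (f i) u) :
    partialDeriv c (fun v => ∑ i ∈ s, f i v) u = ∑ i ∈ s, partialDeriv c (f i) u := by
  simp only [partialDeriv]
  rw [fderiv_fun_sum hf]
  simp

theorem partialDeriv_sqrt (ha : DifferentiableAt ℝ a u) (hpos : 0 < a u) :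
    partialDeriv c (fun v => √(a v)) u = √(a u) * (1 / 2 * (partialDeriv c a u / a u)) := by
  simp only [partialDeriv]
  rw [fderiv_sqrt ha hpos.ne']
  have h := Real.mul_self_sqrt hpos.le
  have h2 := (Real.sqrt_pos.2 hpos).ne'
  have h3 : ∀ d : ℝ, 1 / (2 * √(a u)) * d = √(a u) * (1 / 2 * (d / a u)) := by
    intro d
    nth_rewrite 3 [← h]
    field_simp
  exact h3 _

/-- Jacobi's formula `∂ (det A) = det A · tr (A⁻¹ ∂A)`. -/
theorem partialDeriv_matrix_det {A : E3 → Matrix (Fin 3) (Fin 3) ℝ}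
    (hA : ∀ i j, DifferentiableAt ℝ (fun v => A v i j) u) (hdet : (A u).det ≠ 0) :
    partialDeriv c (fun v => (A v).det) u =
      (A u).det * ∑ i, ∑ j, (A u)⁻¹ i j * partialDeriv c (fun v => A v j i) u := by
  have h : ∀ i j, HasFDerivAt (fun v => A v i j) (fderiv ℝ (fun v => A v i j) u) u :=
    fun i j => (hA i j).hasFDerivAt
  have hD := (((((((h 0 0).mul (h 1 1)).mul (h 2 2)).sub (((h 0 0).mul (h 1 2)).mul (h 2 1))).sub
    (((h 0 1).mul (h 1 0)).mul (h 2 2))).add (((h 0 1).mul (h 1 2)).mul (h 2 0))).add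
    (((h 0 2).mul (h 1 0)).mul (h 2 1))).sub (((h 0 2).mul (h 1 1)).mul (h 2 0))
  have hfun : (fun v => (A v).det) = _ := funext fun v => Matrix.det_fin_three (A v)
  have hinv : ∀ i j, (A u).det * (A u)⁻¹ i j = (A u).adjugate i j := by
    intro i j
    rw [Matrix.inv_def, Ring.inverse_eq_inv', Matrix.smul_apply, smul_eq_mul,
      mul_inv_cancel_left₀ hdet]
  simp only [Finset.mul_sum, ← mul_assoc, hinv]
  rw [hfun, partialDeriv]
  refine (congrArg (fun L : E3 →L[ℝ] ℝ => L (EuclideanSpace.single c (1 : ℝ))) hD.fderiv).trans ?_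
  rw [Matrix.adjugate_fin_three]
  simp [Fin.sum_univ_three, partialDeriv]
  ring

/-- If `dH · G + H · dG = 0` (one row, where `H` and `G` are inverse to each other), then
`dH = -H · dG · H`. -/
theorem eq_neg_sum_of_sum_eq_zero {ι : Type*} [Fintype ι] [DecidableEq ι] {G H dG : ι → ι → ℝ}
    {dH : ι → ℝ} {i j : ι} (h : ∀ l, ∑ k, (dH k * G k l + H i k * dG k l) = 0)
    (hGH : ∀ k, ∑ l, G k l * H l j = if k = j then 1 else 0) :
    dH j = -∑ k, ∑ l, H i k * dG k l * H l j := by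
  have h4 : ∑ l, (∑ k, (dH k * G k l + H i k * dG k l)) * H l j = 0 := by simp [h]
  simp only [add_mul, Finset.sum_add_distrib, Finset.sum_mul] at h4
  rw [Finset.sum_comm] at h4
  simp only [mul_assoc, ← Finset.mul_sum, hGH] at h4
  simp only [mul_ite, mul_one, mul_zero, Finset.sum_ite_eq', Finset.mem_univ, if_true] at h4
  rw [Finset.sum_comm]
  simp only [mul_assoc]
  linarith

/-- The derivative of an inverse matrix, `∂ (A⁻¹) = -A⁻¹ (∂A) A⁻¹`. -/
theorem partialDeriv_matrix_inv {A : E3 → Matrix (Fin 3) (Fin 3) ℝ}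
    (hA : ∀ i j, ContDiffAt ℝ 1 (fun v => A v i j) u) (hdet : (A u).det ≠ 0) (i j : Fin 3) :
    partialDeriv c (fun v => (A v)⁻¹ i j) u =
      -∑ k, ∑ l, (A u)⁻¹ i k * partialDeriv c (fun v => A v k l) u * (A u)⁻¹ l j := by
  have hd : ∀ i j, DifferentiableAt ℝ (fun v => A v i j) u :=
    fun i j => (hA i j).differentiableAt (by simp)
  have hI : ∀ i j, DifferentiableAt ℝ (fun v => (A v)⁻¹ i j) u :=
    fun i j => (contDiffAt_matrix_inv hA hdet i j).differentiableAt (by simp)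
  have hne : ∀ᶠ v in nhds u, (A v).det ≠ 0 :=
    ((contDiffAt_matrix_det hA).continuousAt).eventually_ne hdet
  have h1 : ∀ l, ∑ k, (partialDeriv c (fun v => (A v)⁻¹ i k) u * A u k l +
      (A u)⁻¹ i k * partialDeriv c (fun v => A v k l) u) = 0 := by
    intro l
    have h2 : (fun v => ∑ k, (A v)⁻¹ i k * A v k l) =ᶠ[nhds u]
        fun _ => (1 : Matrix (Fin 3) (Fin 3) ℝ) i l := by
      filter_upwards [hne] with v hv
      rw [← Matrix.nonsing_inv_mul (A v) hv.isUnit, Matrix.mul_apply]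
    have h3 : partialDeriv c (fun v => ∑ k, (A v)⁻¹ i k * A v k l) u = 0 := by
      rw [partialDeriv, h2.fderiv_eq]; simp
    rw [← h3, partialDeriv_sum fun k _ => (hI i k).fun_mul (hd k l)]
    exact Finset.sum_congr rfl fun k _ => (partialDeriv_mul (hI i k) (hd k l)).symm
  have h5 : ∀ k, ∑ l, A u k l * (A u)⁻¹ l j = if k = j then 1 else 0 := by
    intro k
    rw [← Matrix.one_apply, ← Matrix.mul_nonsing_inv (A u) hdet.isUnit, Matrix.mul_apply]
  exact eq_neg_sum_of_sum_eq_zero h1 h5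

end PartialDeriv

/-- The product rule `(T^i_j X^j)_{|i} = T^i_{j|i} X^j + ½ T^{ij} (L_X γ)_{ij}`, as an identity
between the values at one point: `h = γ⁻¹`, `t`, `x` are the components of the inverse metric, the
tensor and the vector field, `dγ`, `dh`, `dt`, `dx` their partial derivatives (the index of
differentiation comes first) and `Γ` the Christoffel symbols. On the left is the coordinate
expression `(√det γ)⁻¹ ∂_i (√det γ γ^{ij} t_{jk} x^k)`. Only the values of `t` are symmetric here,
not its derivatives. -/
theorem sum_divergence_eq (h t γ : Fin 3 → Fin 3 → ℝ) (dγ dt dh Γ : Fin 3 → Fin 3 → Fin 3 → ℝ)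
    (x : Fin 3 → ℝ) (dx : Fin 3 → Fin 3 → ℝ)
    (hh : ∀ i j, h i j = h j i) (ht : ∀ i j, t i j = t j i)
    (hdγ : ∀ c i j, dγ c i j = dγ c j i) (hγ : ∀ i j, γ i j = γ j i)
    (hinv : ∀ i j, ∑ k, h i k * γ k j = if i = j then 1 else 0)
    (hdh : ∀ c i j, dh c i j = -∑ k, ∑ l, h i k * dγ c k l * h l j)
    (hΓ : ∀ k i j, Γ k i j = 1 / 2 * ∑ l, h k l * (dγ i j l + dγ j i l - dγ l i j)) :
    ∑ i, ((1 / 2 * ∑ a, ∑ b, h a b * dγ i b a) * ∑ j, h i j * ∑ k, t j k * x k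
      + ∑ j, (dh i i j * ∑ k, t j k * x k
        + h i j * ∑ k, (dt i j k * x k + t j k * dx i k))) =
    ∑ j, (∑ i, ∑ k, h i k *
        (dt k i j - ∑ l, Γ l k i * t l j - ∑ l, Γ l k j * t i l)) * x j
      + 1 / 2 * ∑ a, ∑ b, (∑ i, ∑ j, h a i * t i j * h j b) *
        ∑ k, (x k * dγ k a b + γ k b * dx a k + γ a k * dx b k) := by
  obtain ⟨Q, hQ⟩ : ∃ Q : Fin 3 → ℝ, ∀ m, Q m = ∑ a, ∑ b, h a b * dγ m b a := ⟨_, fun _ => rfl⟩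
  obtain ⟨P, hP⟩ : ∃ P : Fin 3 → ℝ, ∀ m, P m = ∑ i, ∑ k, h i k * dγ k i m := ⟨_, fun _ => rfl⟩
  obtain ⟨w, hw⟩ : ∃ w : Fin 3 → ℝ, ∀ j, w j = ∑ k, t j k * x k := ⟨_, fun _ => rfl⟩
  obtain ⟨U, hU⟩ : ∃ U : Fin 3 → Fin 3 → ℝ, ∀ a b, U a b = ∑ i, ∑ j, h a i * t i j * h j b :=
    ⟨_, fun _ _ => rfl⟩
  obtain ⟨B, hB⟩ : ∃ B : Fin 3 → ℝ, ∀ j, B j = ∑ i, ∑ k, h i k * ∑ l, Γ l k j * t i l :=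
    ⟨_, fun _ => rfl⟩
  obtain ⟨K, hK⟩ : ∃ K : Fin 3 → ℝ, ∀ l, K l = ∑ i, ∑ k, h i k * Γ l k i := ⟨_, fun _ => rfl⟩
  obtain ⟨J, hJ⟩ : ∃ J : Fin 3 → ℝ, ∀ j, J j = ∑ i, dh i i j := ⟨_, fun _ => rfl⟩
  have eK : ∀ l, K l = ∑ m, h l m * (P m - 1 / 2 * Q m) := by
    intro l
    rw [hK]
    simp only [hP, hQ, hΓ, Fin.sum_univ_three, hh 1 0, hh 2 0, hh 2 1, fun c => hdγ c 1 0,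
      fun c => hdγ c 2 0, fun c => hdγ c 2 1]
    ring
  have eJ : ∀ j, J j = -∑ m, h j m * P m := by
    intro j
    rw [hJ]
    simp only [hP, hdh, Fin.sum_univ_three, hh _ j, hh 1 0, hh 2 0, hh 2 1, fun c => hdγ c 1 0,
      fun c => hdγ c 2 0, fun c => hdγ c 2 1]
    ring
  have hUs : ∀ a b, U a b = U b a := by
    intro a b
    simp only [hU, Fin.sum_univ_three, hh _ a, hh _ b, ht 1 0, ht 2 0, ht 2 1]
    ring
  have eB : ∀ j, B j = 1 / 2 * ∑ k, ∑ m, U k m * dγ j k m := by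
    intro j
    have h1 : B j = 1 / 2 * ∑ k, ∑ m, U k m * (dγ k j m + dγ j k m - dγ m k j) := by
      obtain ⟨V, hV⟩ : ∃ V : Fin 3 → Fin 3 → ℝ, ∀ k m, V k m = dγ k j m + dγ j k m - dγ m k j :=
        ⟨_, fun _ _ => rfl⟩
      simp only [← hV] at hΓ ⊢
      simp only [hB, hΓ, ← hV, hU, Fin.sum_univ_three, hh 1 0, hh 2 0, hh 2 1]
      ring
    rw [h1]
    simp only [Fin.sum_univ_three, hUs 1 0, hUs 2 0, hUs 2 1, fun c a => hdγ c a j,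
      fun c => hdγ c 1 0, fun c => hdγ c 2 0, fun c => hdγ c 2 1]
    ring
  have eC : ∀ a k, ∑ b, U a b * γ k b = ∑ i, h a i * t i k := by
    intro a k
    have h1 : ∑ b, U a b * γ k b = ∑ i, ∑ j, h a i * t i j * ∑ b, h j b * γ b k := by
      simp only [hU, Fin.sum_univ_three, hγ k]
      ring
    rw [h1]
    simp [hinv]
  have eC2 : 1 / 2 * ∑ a, ∑ b, U a b * ∑ k, (x k * dγ k a b + γ k b * dx a k + γ a k * dx b k) =
      ∑ k, B k * x k + ∑ a, ∑ k, (∑ i, h a i * t i k) * dx a k := by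
    simp only [eB, ← eC]
    simp only [Fin.sum_univ_three, hUs 1 0, hUs 2 0, hUs 2 1, hγ 1 0, hγ 2 0, hγ 2 1,
      fun c => hdγ c 1 0, fun c => hdγ c 2 0, fun c => hdγ c 2 1]
    ring
  have eR : ∑ j, (∑ i, ∑ k, h i k *
        (dt k i j - ∑ l, Γ l k i * t l j - ∑ l, Γ l k j * t i l)) * x j =
      ∑ j, (∑ i, ∑ k, h i k * dt k i j) * x j - ∑ l, K l * w l - ∑ j, B j * x j := by
    simp only [hK, hw, hB]
    simp only [Fin.sum_univ_three]
    ring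
  have eL : ∑ i, ((1 / 2 * Q i) * ∑ j, h i j * w j
      + ∑ j, (dh i i j * w j + h i j * ∑ k, (dt i j k * x k + t j k * dx i k))) =
      ∑ i, (1 / 2 * Q i) * ∑ j, h i j * w j + ∑ j, J j * w j +
      ∑ j, (∑ i, ∑ k, h i k * dt k i j) * x j + ∑ a, ∑ k, (∑ i, h a i * t i k) * dx a k := by
    simp only [hJ]
    simp only [Fin.sum_univ_three, hh 1 0, hh 2 0, hh 2 1]
    ring
  simp only [← hQ, ← hw, ← hU]
  rw [eL, eR, eC2]
  simp only [eK, eJ]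
  simp only [Fin.sum_univ_three, hh 1 0, hh 2 0, hh 2 1]
  ring

section

variable {M : Type*} [TopologicalSpace M] [ChartedSpace E3 M] [IsManifold (𝓡 3) ∞ M]
  {e : OpenPartialHomeomorph M E3} {u : E3} (g : Metric3 M)

/-- The components `√(det γ) Y^i` of the flux field `Y^i = T^i_j X^j` as a vector density: its
coordinate divergence `∂_i (√(det γ) Y^i)` is `√(det γ)` times the covariant divergence of `Y`. -/
def fluxCoord (T : CovTensor2 M) (X : VecField M) (e : OpenPartialHomeomorph M E3) (i : Fin 3)
    (u : E3) : ℝ :=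
  √(metricMatrix g e u).det * vecCoord (fluxField g T X) e i u

/-- `X` is continuously differentiable near `x`. In contrast to `C^∞` at a point, this is an open
condition on `x`. -/
def C1VecAt (X : VecField M) (x : M) : Prop :=
  ContMDiffAt (𝓡 3) (𝓡 3).tangent 1 (fun y => (⟨y, X y⟩ : TangentBundle (𝓡 3) M)) x

/-- `T` is continuously differentiable near `x`. -/
def C1TensorAt (T : CovTensor2 M) (x : M) : Prop :=
  ContMDiffAt (𝓡 3) ((𝓡 3).prod 𝓘(ℝ, E3 →L[ℝ] E3 →L[ℝ] ℝ)) 1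
    (fun y => TotalSpace.mk' (E3 →L[ℝ] E3 →L[ℝ] ℝ)
      (E := fun y : M => TangentSpace (𝓡 3) y →L[ℝ] TangentSpace (𝓡 3) y →L[ℝ] ℝ) y (T y)) x

theorem contDiffAt_vecCoord_fluxField {T : CovTensor2 M} {X : VecField M}
    (he : e ∈ smoothCharts M) (hu : u ∈ e.target) (hT : C1TensorAt T (e.symm u))
    (hX : C1VecAt X (e.symm u)) (i : Fin 3) :
    ContDiffAt ℝ 1 (vecCoord (fluxField g T X) e i) u := by
  have h2 : ContDiffAt ℝ 1 (fun v => ∑ j, invMetricCoord g e i j v *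
      ∑ k, tensorCoord T e j k v * vecCoord X e k v) u :=
    ContDiffAt.sum fun j _ => ((contDiffAt_invMetricCoord g he hu i j).of_le (by simp)).mul
      (ContDiffAt.sum fun k _ => (contDiffAt_tensorCoord (by simp) he hu hT j k).mul
        (contDiffAt_vecCoord (by simp) he hu hX k))
  refine h2.congr_of_eventuallyEq ?_
  filter_upwards [e.open_target.mem_nhds hu] with v hv
  exact vecCoord_fluxField g T X he hv i

theorem contDiffAt_fluxCoord {T : CovTensor2 M} {X : VecField M} (he : e ∈ smoothCharts M)
    (hu : u ∈ e.target) (hT : C1TensorAt T (e.symm u)) (hX : C1VecAt X (e.symm u)) (i : Fin 3) :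
    ContDiffAt ℝ 1 (fluxCoord g T X e i) u :=
  (((contDiffAt_det_metricMatrix g he hu).of_le (by simp)).sqrt
    (det_metricMatrix_pos g he hu).ne').mul (contDiffAt_vecCoord_fluxField g he hu hT hX i)

/-- The flux field `T^i_j X^j` is divergence-free at the points of `V`. The hypotheses on `V` are
pointwise, so `V` need not be open. -/
theorem sum_partialDeriv_fluxCoord {T : CovTensor2 M} {X : VecField M} {V : Set M}
    (hXconf : IsConformalKillingOn g X V) (hTsymm : IsSymmetricOn T V)
    (hTtrace : IsTracelessOn g T V) (hTdiv : IsDivergenceFreeOn g T V) (he : e ∈ smoothCharts M)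
    (hu : u ∈ e.target) (huV : e.symm u ∈ V) (hT : C1TensorAt T (e.symm u))
    (hX : C1VecAt X (e.symm u)) : ∑ i, partialDeriv i (fluxCoord g T X e i) u = 0 := by
  have dX : ∀ k, DifferentiableAt ℝ (vecCoord X e k) u := fun k =>
    (contDiffAt_vecCoord (by simp) he hu hX k).differentiableAt (by simp)
  have dT : ∀ i j, DifferentiableAt ℝ (tensorCoord T e i j) u := fun i j =>
    (contDiffAt_tensorCoord (by simp) he hu hT i j).differentiableAt (by simp)
  have cγ : ∀ i j, ContDiffAt ℝ 1 (fun v => metricMatrix g e v i j) u := fun i j =>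
    (contDiffAt_metricCoord g he hu i j).of_le (by simp)
  have dγ : ∀ i j, DifferentiableAt ℝ (fun v => metricMatrix g e v i j) u := fun i j =>
    (cγ i j).differentiableAt (by simp)
  have dh : ∀ i j, DifferentiableAt ℝ (invMetricCoord g e i j) u := fun i j =>
    (contDiffAt_invMetricCoord g he hu i j).differentiableAt (by simp)
  have hpos := det_metricMatrix_pos g he hu
  have dD : DifferentiableAt ℝ (fun v => (metricMatrix g e v).det) u :=
    (contDiffAt_det_metricMatrix g he hu).differentiableAt (by simp)
  have dω : ∀ j, DifferentiableAt ℝ (fun v => ∑ k, tensorCoord T e j k v * vecCoord X e k v) u :=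
    fun j => DifferentiableAt.fun_sum fun k _ => (dT j k).fun_mul (dX k)
  have hF : ∀ i, fluxCoord g T X e i =ᶠ[nhds u] fun v => √(metricMatrix g e v).det *
      ∑ j, invMetricCoord g e i j v * ∑ k, tensorCoord T e j k v * vecCoord X e k v := by
    intro i
    filter_upwards [e.open_target.mem_nhds hu] with v hv
    rw [fluxCoord, vecCoord_fluxField g T X he hv i]
  have hder : ∀ i, partialDeriv i (fluxCoord g T X e i) u = √(metricMatrix g e u).det *
      ((1 / 2 * ∑ a, ∑ b, invMetricCoord g e a b u * partialDeriv i (metricCoord g e b a) u) *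
        ∑ j, invMetricCoord g e i j u * ∑ k, tensorCoord T e j k u * vecCoord X e k u
      + ∑ j, (partialDeriv i (invMetricCoord g e i j) u *
          ∑ k, tensorCoord T e j k u * vecCoord X e k u
        + invMetricCoord g e i j u * ∑ k, (partialDeriv i (tensorCoord T e j k) u * vecCoord X e k u
          + tensorCoord T e j k u * partialDeriv i (vecCoord X e k) u))) := by
    intro i
    rw [partialDeriv, (hF i).fderiv_eq, ← partialDeriv,
      partialDeriv_mul (dD.sqrt hpos.ne')
        (DifferentiableAt.fun_sum fun j _ => (dh i j).fun_mul (dω j)),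
      partialDeriv_sqrt dD hpos, partialDeriv_matrix_det dγ hpos.ne',
      partialDeriv_sum fun j _ => (dh i j).fun_mul (dω j), mul_div_cancel_left₀ _ hpos.ne']
    have h1 : ∀ j, partialDeriv i (fun v => invMetricCoord g e i j v *
        ∑ k, tensorCoord T e j k v * vecCoord X e k v) u =
        partialDeriv i (invMetricCoord g e i j) u *
          ∑ k, tensorCoord T e j k u * vecCoord X e k u
        + invMetricCoord g e i j u * ∑ k, (partialDeriv i (tensorCoord T e j k) u * vecCoord X e k u
          + tensorCoord T e j k u * partialDeriv i (vecCoord X e k) u) := by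
      intro j
      rw [partialDeriv_mul (dh i j) (dω j), partialDeriv_sum fun k _ => (dT j k).fun_mul (dX k)]
      congr 2
      exact Finset.sum_congr rfl fun k _ => partialDeriv_mul (dT j k) (dX k)
    simp only [h1]
    rw [mul_assoc, ← mul_add]
    rfl
  simp only [hder]
  rw [← Finset.mul_sum]
  have hx : e (e.symm u) = u := e.right_inv hu
  have hmem : e.symm u ∈ V ∩ e.source := ⟨huV, e.map_target hu⟩
  have key := sum_divergence_eq (fun i j => invMetricCoord g e i j u)
    (fun i j => tensorCoord T e i j u) (fun i j => metricCoord g e i j u)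
    (fun c i j => partialDeriv c (metricCoord g e i j) u)
    (fun c i j => partialDeriv c (tensorCoord T e i j) u)
    (fun c i j => partialDeriv c (invMetricCoord g e i j) u)
    (fun k i j => christoffel g e k i j u)
    (fun k => vecCoord X e k u) (fun c k => partialDeriv c (vecCoord X e k) u)
    (fun i j => invMetricCoord_symm g e u i j) (fun i j => hTsymm _ huV _ _)
    (fun c i j => by
      have : metricCoord g e i j = metricCoord g e j i := funext fun v => metricCoord_symm g e v i j
      rw [this])
    (fun i j => metricCoord_symm g e u i j)
    (sum_invMetricCoord_mul_metricCoord g he hu)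
    (fun c i j => partialDeriv_matrix_inv cγ hpos.ne' i j)
    (fun k i j => rfl)
  rw [key]
  have hdiv : ∀ j, divCoord g T e j u = 0 := by
    intro j
    have := hTdiv e he _ hmem j
    rwa [hx] at this
  obtain ⟨lam, hlam⟩ := hXconf
  have hL : ∀ a b, lieMetricCoord g X e a b u = lam (e.symm u) * metricCoord g e a b u := by
    intro a b
    have := hlam e he _ hmem a b
    rwa [hx] at this
  have htr : ∑ i, ∑ j, invMetricCoord g e i j u * tensorCoord T e i j u = 0 := by
    have := hTtrace e he _ hmem
    rwa [hx] at this
  have h1 : ∑ j, divCoord g T e j u * vecCoord X e j u = 0 := by simp [hdiv]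
  have h2 : ∑ a, ∑ b, (∑ i, ∑ j, invMetricCoord g e a i u * tensorCoord T e i j u *
      invMetricCoord g e j b u) * lieMetricCoord g X e a b u = 0 := by
    have h3 : ∀ a j, ∑ b, invMetricCoord g e j b u * metricCoord g e a b u =
        if j = a then 1 else 0 := by
      intro a j
      simp only [metricCoord_symm g e u a]
      exact sum_invMetricCoord_mul_metricCoord g he hu j a
    have h4 : ∀ a, ∑ b, (∑ i, ∑ j, invMetricCoord g e a i u * tensorCoord T e i j u *
        invMetricCoord g e j b u) * lieMetricCoord g X e a b u =
        lam (e.symm u) * ∑ i, invMetricCoord g e a i u * tensorCoord T e i a u := by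
      intro a
      have h5 : ∑ b, (∑ i, ∑ j, invMetricCoord g e a i u * tensorCoord T e i j u *
          invMetricCoord g e j b u) * lieMetricCoord g X e a b u =
          lam (e.symm u) * ∑ i, ∑ j, invMetricCoord g e a i u * tensorCoord T e i j u *
            ∑ b, invMetricCoord g e j b u * metricCoord g e a b u := by
        simp only [hL, Fin.sum_univ_three]
        ring
      rw [h5]
      simp [h3]
    simp only [h4]
    rw [← Finset.mul_sum]
    have h6 : ∀ i a, tensorCoord T e i a u = tensorCoord T e a i u :=
      fun i a => hTsymm _ huV _ _
    have h7 : ∑ a, ∑ i, invMetricCoord g e a i u * tensorCoord T e i a u = 0 := by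
      rw [← htr]
      exact Finset.sum_congr rfl fun a _ => Finset.sum_congr rfl fun i _ => by rw [h6 i a]
    rw [h7, mul_zero]
  have : ∀ (r s p : ℝ), s = 0 → p = 0 → r * (s + 1 / 2 * p) = 0 := by
    rintro r s p rfl rfl; simp
  exact this _ _ _ h1 h2

end

/-! ### Riemannian measures of parametrized patches -/

section Patch

variable {M : Type*} [TopologicalSpace M] [ChartedSpace E3 M] [IsManifold (𝓡 3) ∞ M]
  {n : ℕ} (g : Metric3 M)

/-- The derivative of `ψ` at `w`. The tangent space at `ψ w` is by definition the model space `ℝ³`,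
which makes the derivatives at points with different images comparable. -/
def paramDeriv (ψ : EuclideanSpace ℝ (Fin n) → M) (w : EuclideanSpace ℝ (Fin n)) :
    EuclideanSpace ℝ (Fin n) →L[ℝ] E3 :=
  mfderiv 𝓘(ℝ, EuclideanSpace ℝ (Fin n)) (𝓡 3) ψ w

/-- The Gram matrix of the metric in the parametrization `ψ`. -/
def gramMatrix (ψ : EuclideanSpace ℝ (Fin n) → M) (w : EuclideanSpace ℝ (Fin n)) :
    Matrix (Fin n) (Fin n) ℝ :=
  Matrix.of fun a b => g.inner (ψ w) (paramDeriv ψ w (EuclideanSpace.single a (1 : ℝ)))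
    (paramDeriv ψ w (EuclideanSpace.single b (1 : ℝ)))

/-- The Riemannian volume density `√(det (γ(∂_a ψ, ∂_b ψ)))` of the parametrization `ψ`. -/
def gramDensity (ψ : EuclideanSpace ℝ (Fin n) → M) (w : EuclideanSpace ℝ (Fin n)) : ℝ :=
  √(gramMatrix g ψ w).det

variable {g}

/-- Under a reparametrization `φ` the volume density is multiplied by `|det Dφ|`. -/
theorem gramDensity_eq_abs_det_mul {ψ ψ' : EuclideanSpace ℝ (Fin n) → M}
    {φ : EuclideanSpace ℝ (Fin n) → EuclideanSpace ℝ (Fin n)}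
    {φ' : EuclideanSpace ℝ (Fin n) →L[ℝ] EuclideanSpace ℝ (Fin n)}
    {w : EuclideanSpace ℝ (Fin n)} (hφ : HasFDerivAt φ φ' w)
    (hψ' : MDifferentiableAt 𝓘(ℝ, EuclideanSpace ℝ (Fin n)) (𝓡 3) ψ' (φ w))
    (h : ψ =ᶠ[nhds w] ψ' ∘ φ) :
    gramDensity g ψ w = |φ'.det| * gramDensity g ψ' (φ w) := by
  have hd : paramDeriv ψ w = (paramDeriv ψ' (φ w)).comp φ' := by
    have h1 : paramDeriv ψ w = paramDeriv (ψ' ∘ φ) w := h.mfderiv_eq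
    rw [h1]
    exact (hψ'.hasMFDerivAt.comp w hφ.hasMFDerivAt).mfderiv
  have hx : ψ w = ψ' (φ w) := h.eq_of_nhds
  let b := (EuclideanSpace.basisFun (Fin n) ℝ).toBasis
  let J : Matrix (Fin n) (Fin n) ℝ := LinearMap.toMatrix b b φ'.toLinearMap
  have hJ : ∀ i j, J i j = φ' (EuclideanSpace.single j (1 : ℝ)) i := by
    intro i j
    simp [J, b, LinearMap.toMatrix_apply]
  have hdet : J.det = φ'.det := LinearMap.det_toMatrix b _
  have hG : gramMatrix g ψ w = J.transpose * gramMatrix g ψ' (φ w) * J := by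
    let B : E3 →L[ℝ] E3 →L[ℝ] ℝ := g.inner (ψ' (φ w))
    let D : EuclideanSpace ℝ (Fin n) →L[ℝ] E3 := paramDeriv ψ' (φ w)
    have hG0 : ∀ a b, gramMatrix g ψ w a b = B (D (φ' (EuclideanSpace.single a (1 : ℝ))))
        (D (φ' (EuclideanSpace.single b (1 : ℝ)))) := by
      intro a b
      have hQ : ∀ (x y : M) (v z : E3), x = y → (g.inner x : E3 →L[ℝ] E3 →L[ℝ] ℝ) v z =
          (g.inner y : E3 →L[ℝ] E3 →L[ℝ] ℝ) v z := by rintro x _ v z rfl; rfl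
      simp only [gramMatrix, Matrix.of_apply, hd]
      exact hQ _ _ _ _ hx
    have hG1 : ∀ a b, gramMatrix g ψ' (φ w) a b = B (D (EuclideanSpace.single a (1 : ℝ)))
        (D (EuclideanSpace.single b (1 : ℝ))) := fun a b => rfl
    ext a b
    rw [hG0, Matrix.mul_apply]
    simp only [Matrix.mul_apply, Matrix.transpose_apply, hG1, hJ]
    rw [euclidean_eq_sum_single (φ' (EuclideanSpace.single a (1 : ℝ))),
      euclidean_eq_sum_single (φ' (EuclideanSpace.single b (1 : ℝ)))]
    simp only [map_sum, map_smul, sum_apply, smul_apply, smul_eq_mul, Finset.sum_mul,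
      Finset.mul_sum]
    rw [← euclidean_eq_sum_single, ← euclidean_eq_sum_single]
    exact Finset.sum_congr rfl fun i _ => Finset.sum_congr rfl fun j _ => by ring
  rw [gramDensity, hG, Matrix.det_mul, Matrix.det_mul, Matrix.det_transpose, hdet, gramDensity,
    mul_comm, ← mul_assoc, Real.sqrt_mul (mul_self_nonneg _), Real.sqrt_mul_self_eq_abs]

variable (g) in
/-- A parametrized `n`-dimensional patch: `ψ` maps the open set `O` of `ℝⁿ` into the open set `U` of
`M`, and `χ`, defined on all of `U`, restricts to the inverse of `ψ`. -/
structure IsPatch (O : Set (EuclideanSpace ℝ (Fin n))) (ψ : EuclideanSpace ℝ (Fin n) → M)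
    (χ : M → EuclideanSpace ℝ (Fin n)) (U : Set M) : Prop where
  isOpen_dom : IsOpen O
  isOpen_cod : IsOpen U
  mapsTo : MapsTo ψ O U
  leftInv : ∀ w ∈ O, χ (ψ w) = w
  mdiff : ∀ w ∈ O, MDifferentiableAt 𝓘(ℝ, EuclideanSpace ℝ (Fin n)) (𝓡 3) ψ w
  mdiff_inv : ∀ x ∈ U, MDifferentiableAt (𝓡 3) 𝓘(ℝ, EuclideanSpace ℝ (Fin n)) χ x
  continuousOn_density : ContinuousOn (gramDensity g ψ) O

/-- The image of the patch `ψ` meets `U'` only in the image of the patch `ψ'`. -/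
def PatchCompatible (O : Set (EuclideanSpace ℝ (Fin n))) (ψ : EuclideanSpace ℝ (Fin n) → M)
    (O' : Set (EuclideanSpace ℝ (Fin n))) (ψ' : EuclideanSpace ℝ (Fin n) → M)
    (χ' : M → EuclideanSpace ℝ (Fin n)) (U' : Set M) : Prop :=
  ∀ w ∈ O, ψ w ∈ U' → χ' (ψ w) ∈ O' ∧ ψ' (χ' (ψ w)) = ψ w

variable (g) in
/-- The `n`-dimensional Riemannian measure of the patch parametrized by `ψ` on `O`. -/
def patchMeasure [MeasurableSpace M] (O : Set (EuclideanSpace ℝ (Fin n)))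
    (ψ : EuclideanSpace ℝ (Fin n) → M) : Measure M :=
  Measure.map ψ ((volume.restrict O).withDensity fun w => ENNReal.ofReal (gramDensity g ψ w))

variable {O O' : Set (EuclideanSpace ℝ (Fin n))} {ψ ψ' : EuclideanSpace ℝ (Fin n) → M}
  {χ χ' : M → EuclideanSpace ℝ (Fin n)} {U U' : Set M}

namespace IsPatch

theorem continuousOn (h : IsPatch g O ψ χ U) : ContinuousOn ψ O :=
  fun w hw => (h.mdiff w hw).continuousAt.continuousWithinAt

theorem injOn (h : IsPatch g O ψ χ U) : InjOn ψ O := fun w hw z hz hwz => by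
  rw [← h.leftInv w hw, hwz, h.leftInv z hz]

variable [MeasurableSpace M] [BorelSpace M]

theorem aemeasurable (h : IsPatch g O ψ χ U) : AEMeasurable ψ ((volume.restrict O).withDensity
    fun w => ENNReal.ofReal (gramDensity g ψ w)) :=
  (h.continuousOn.aemeasurable h.isOpen_dom.measurableSet).mono_ac
    (withDensity_absolutelyContinuous _ _)

theorem measurableSet_preimage (h : IsPatch g O ψ χ U) {B : Set M} (hB : MeasurableSet B) :
    MeasurableSet (O ∩ ψ ⁻¹' B) := by
  have h1 : Measurable (fun w : O => ψ w) :=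
    (continuousOn_iff_continuous_domRestrict.1 h.continuousOn).measurable
  have h2 := h.isOpen_dom.measurableSet.subtype_image (h1 hB)
  convert h2 using 1
  ext w
  simp [and_comm]

theorem patchMeasure_restrict (h : IsPatch g O ψ χ U) {B : Set M} (hB : MeasurableSet B)
    (hOB : MapsTo ψ O B) : (patchMeasure g O ψ).restrict B = patchMeasure g O ψ := by
  rw [patchMeasure, Measure.restrict_map_of_aemeasurable h.aemeasurable hB]
  have h0 : ((volume.restrict O).withDensity fun w => ENNReal.ofReal (gramDensity g ψ w))
      (ψ ⁻¹' B)ᶜ = 0 := by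
    refine measure_mono_null (t := Oᶜ) (fun w hw hO => hw (hOB hO)) ?_
    refine withDensity_absolutelyContinuous _ _ ?_
    rw [Measure.restrict_apply h.isOpen_dom.measurableSet.compl]
    simp
  rw [Measure.restrict_eq_self_of_ae_mem (by rw [ae_iff]; exact h0)]

theorem patchMeasure_restrict_comm (h : IsPatch g O ψ χ U) (h' : IsPatch g O' ψ' χ' U')
    (hc : PatchCompatible O ψ O' ψ' χ' U') (hc' : PatchCompatible O' ψ' O ψ χ U) :
    (patchMeasure g O ψ).restrict U' = (patchMeasure g O' ψ').restrict U := by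
  refine map_withDensity_restrict_eq volume h.isOpen_dom.measurableSet h'.isOpen_dom.measurableSet
    h.isOpen_cod.measurableSet h'.isOpen_cod.measurableSet h.aemeasurable h'.aemeasurable
    (fun B hB => h.measurableSet_preimage hB) (fun B hB => h'.measurableSet_preimage hB)
    h.mapsTo h.injOn (fun w => χ' (ψ w)) (fun w => fderiv ℝ (fun w => χ' (ψ w)) w) ?_ ?_
  · intro w hw hwU
    have hd : DifferentiableAt ℝ (fun w => χ' (ψ w)) w :=
      ((h'.mdiff_inv _ hwU).comp w (h.mdiff w hw)).differentiableAt
    refine ⟨(hc w hw hwU).1, (hc w hw hwU).2, hd.hasFDerivAt, ?_⟩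
    rw [← ENNReal.ofReal_mul (abs_nonneg _)]
    congr 1
    refine gramDensity_eq_abs_det_mul hd.hasFDerivAt (h'.mdiff _ (hc w hw hwU).1) ?_
    filter_upwards [h.isOpen_dom.mem_nhds hw,
      (h.mdiff w hw).continuousAt.preimage_mem_nhds (h'.isOpen_cod.mem_nhds hwU)] with z hz hzU
    exact (hc z hz hzU).2.symm
  · intro w' hw' hwU
    obtain ⟨h1, h2⟩ := hc' w' hw' hwU
    refine ⟨χ (ψ' w'), h1, ?_, ?_⟩
    · rw [h2]; exact h'.mapsTo hw'
    · rw [h2, h'.leftInv w' hw']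

theorem patchMeasure_lt_top (h : IsPatch g O ψ χ U) {K : Set M} (hKm : MeasurableSet K)
    (hK : IsCompact K) (hKO : K ⊆ ψ '' O) : patchMeasure g O ψ K < ⊤ := by
  have himg : O ∩ ψ ⁻¹' K = χ '' K := by
    ext w
    constructor
    · rintro ⟨hw, hwK⟩
      exact ⟨ψ w, hwK, h.leftInv w hw⟩
    · rintro ⟨x, hx, rfl⟩
      obtain ⟨z, hz, rfl⟩ := hKO hx
      rw [h.leftInv z hz]
      exact ⟨hz, hx⟩
  have hcpt : IsCompact (χ '' K) := hK.image_of_continuousOn fun x hx => by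
    obtain ⟨z, hz, rfl⟩ := hKO hx
    exact (h.mdiff_inv _ (h.mapsTo hz)).continuousAt.continuousWithinAt
  have hsub : χ '' K ⊆ O := himg ▸ inter_subset_left
  rw [← h.patchMeasure_restrict h.isOpen_cod.measurableSet h.mapsTo, Measure.restrict_apply hKm,
    patchMeasure, Measure.map_apply_of_aemeasurable h.aemeasurable
      (hKm.inter h.isOpen_cod.measurableSet)]
  have h1 : ((volume.restrict O).withDensity fun w => ENNReal.ofReal (gramDensity g ψ w))
      (ψ ⁻¹' (K ∩ U)) ≤ ((volume.restrict O).withDensity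
        fun w => ENNReal.ofReal (gramDensity g ψ w)) (χ '' K) := by
    refine measure_mono_ae ?_
    have : ∀ᵐ w ∂((volume.restrict O).withDensity
        fun w => ENNReal.ofReal (gramDensity g ψ w)), w ∈ O :=
      (withDensity_absolutelyContinuous _ _).ae_le (ae_restrict_mem h.isOpen_dom.measurableSet)
    filter_upwards [this] with w hw hwK
    exact himg ▸ ⟨hw, hwK.1⟩
  refine h1.trans_lt ?_
  rw [withDensity_apply _ hcpt.measurableSet, Measure.restrict_restrict hcpt.measurableSet,
    inter_eq_left.2 hsub]
  exact ((h.continuousOn_density.mono hsub).integrableOn_compact hcpt).lintegral_lt_top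

theorem integral_patchMeasure (h : IsPatch g O ψ χ U) {f : M → ℝ}
    (hf : AEStronglyMeasurable f (patchMeasure g O ψ)) :
    ∫ x, f x ∂(patchMeasure g O ψ) = ∫ w in O, gramDensity g ψ w * f (ψ w) := by
  rw [patchMeasure, integral_map h.aemeasurable hf,
    integral_withDensity_eq_integral_toReal_smul₀
      (h.continuousOn_density.aemeasurable h.isOpen_dom.measurableSet).ennreal_ofReal
      (Filter.Eventually.of_forall fun _ => ENNReal.ofReal_lt_top)]
  refine integral_congr_ae (Filter.Eventually.of_forall fun w => ?_)
  simp only [smul_eq_mul]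
  rw [gramDensity, ENNReal.toReal_ofReal (Real.sqrt_nonneg _)]

end IsPatch

end Patch

/-! ### The volume measure and the area measure of a surface -/

section Slices

variable {M : Type*} [TopologicalSpace M] {e e' : OpenPartialHomeomorph M E3} {A : Set M}

theorem patchCompatible_chart :
    PatchCompatible e.target e.symm e'.target e'.symm e' e'.source :=
  fun _ _ hu' => ⟨e'.map_source hu', e'.left_inv hu'⟩

variable [ChartedSpace E3 M]

/-- `planePoint` as a linear map. -/
def planeLin : EuclideanSpace ℝ (Fin 2) →L[ℝ] E3 :=
  LinearMap.toContinuousLinearMap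
    { toFun := planePoint
      map_add' := fun v w => by ext i; fin_cases i <;> simp [planePoint]
      map_smul' := fun c v => by ext i; fin_cases i <;> simp [planePoint] }

/-- The projection of `ℝ³` onto the coordinate plane `u² = 0`. -/
def planeProj : E3 →L[ℝ] EuclideanSpace ℝ (Fin 2) :=
  LinearMap.toContinuousLinearMap
    { toFun := fun u => !₂[u 0, u 1]
      map_add' := fun v w => by ext i; fin_cases i <;> simp
      map_smul' := fun c v => by ext i; fin_cases i <;> simp }

theorem planeLin_apply (w : EuclideanSpace ℝ (Fin 2)) : planeLin w = planePoint w := rfl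

theorem planeProj_planePoint (w : EuclideanSpace ℝ (Fin 2)) : planeProj (planePoint w) = w := by
  ext i; fin_cases i <;> simp [planeProj, planePoint]

theorem planePoint_planeProj {u : E3} (hu : u 2 = 0) : planePoint (planeProj u) = u := by
  ext i; fin_cases i <;> simp [planeProj, planePoint, hu]

theorem planePoint_two (w : EuclideanSpace ℝ (Fin 2)) : planePoint w 2 = 0 := by simp [planePoint]

/-- The part of the coordinate plane that lies in the domain of the coordinates `e`. -/
def sliceDom (e : OpenPartialHomeomorph M E3) : Set (EuclideanSpace ℝ (Fin 2)) :=
  {w | planePoint w ∈ e.target}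

/-- The parametrization of the coordinate plane `u² = 0` of `e`. -/
def sliceParam (e : OpenPartialHomeomorph M E3) (w : EuclideanSpace ℝ (Fin 2)) : M :=
  e.symm (planePoint w)

theorem IsSliceChart.sliceParam_mem (h : IsSliceChart A e) {w : EuclideanSpace ℝ (Fin 2)}
    (hw : w ∈ sliceDom e) : sliceParam e w ∈ A :=
  (h.2 _ (e.map_target hw)).2 (by
    change e (e.symm (planePoint w)) 2 = 0
    rw [e.right_inv hw, planePoint_two])

theorem IsSliceChart.eq_sliceParam (h : IsSliceChart A e) {x : M} (hxA : x ∈ A)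
    (hx : x ∈ e.source) : planeProj (e x) ∈ sliceDom e ∧ sliceParam e (planeProj (e x)) = x := by
  have h1 := planePoint_planeProj ((h.2 x hx).1 hxA)
  exact ⟨by rw [sliceDom, mem_ofPred_eq, h1]; exact e.map_source hx,
    by rw [sliceParam, h1, e.left_inv hx]⟩

theorem mdifferentiableAt_planePoint (w : EuclideanSpace ℝ (Fin 2)) :
    MDifferentiableAt 𝓘(ℝ, EuclideanSpace ℝ (Fin 2)) 𝓘(ℝ, E3) planePoint w :=
  planeLin.differentiableAt.mdifferentiableAt

theorem patchCompatible_slice (h : IsSliceChart A e) (h' : IsSliceChart A e') :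
    PatchCompatible (sliceDom e) (sliceParam e) (sliceDom e') (sliceParam e')
      (fun x => planeProj (e' x)) e'.source :=
  fun _ hw hw' => h'.eq_sliceParam (h.sliceParam_mem hw) hw'

end Slices

section GlobalMeasures

variable {M : Type*} [TopologicalSpace M] [ChartedSpace E3 M] [IsManifold (𝓡 3) ∞ M]
  {e e' : OpenPartialHomeomorph M E3} {A : Set M} (g : Metric3 M)

theorem gramMatrix_chart_symm (e : OpenPartialHomeomorph M E3) (u : E3) :
    gramMatrix g e.symm u = metricMatrix g e u := rfl

theorem isPatch_chart (he : e ∈ smoothCharts M) : IsPatch g e.target e.symm e e.source where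
  isOpen_dom := e.open_target
  isOpen_cod := e.open_source
  mapsTo := fun _ hu => e.map_target hu
  leftInv := fun _ hu => e.right_inv hu
  mdiff := fun _ hu => (mdifferentiable_of_mem_smoothCharts he).mdifferentiableAt_symm hu
  mdiff_inv := fun _ hx => (mdifferentiable_of_mem_smoothCharts he).mdifferentiableAt hx
  continuousOn_density := fun _ hu =>
    (contDiffAt_det_metricMatrix g he hu).continuousAt.sqrt.continuousWithinAt

/-- The Riemannian volume measure, encoded like `surfaceArea` as the least measure that dominates
the volume `√(det γ) du` of every coordinate patch. -/
def volumeMeasure [MeasurableSpace M] : Measure M :=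
  ⨆ e : smoothCharts M, patchMeasure g e.1.target e.1.symm

/-- In each chart the volume measure is `√(det γ) du`. -/
theorem volumeMeasure_restrict [SecondCountableTopology M] [MeasurableSpace M] [BorelSpace M]
    (he : e ∈ smoothCharts M) :
    (volumeMeasure g).restrict e.source = patchMeasure g e.target e.symm :=
  restrict_iSup_of_agree (fun e : smoothCharts M => patchMeasure g e.1.target e.1.symm)
    (fun e => e.1.source) (fun e => e.1.open_source)
    (fun e => (isPatch_chart g e.2).patchMeasure_restrict e.1.open_source.measurableSet
      (isPatch_chart g e.2).mapsTo)
    (fun e e' => (isPatch_chart g e.2).patchMeasure_restrict_comm (isPatch_chart g e'.2)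
      patchCompatible_chart patchCompatible_chart) ⟨e, he⟩

theorem gramDensity_sliceParam (he : e ∈ smoothCharts M) {w : EuclideanSpace ℝ (Fin 2)}
    (hw : w ∈ sliceDom e) : gramDensity g (sliceParam e) w = areaDensity g e w := by
  have hd : paramDeriv (sliceParam e) w = (paramDeriv e.symm (planePoint w)).comp planeLin := by
    have h1 : HasMFDerivAt 𝓘(ℝ, EuclideanSpace ℝ (Fin 2)) 𝓘(ℝ, E3) planePoint w planeLin :=
      planeLin.hasFDerivAt.hasMFDerivAt
    exact (((mdifferentiable_of_mem_smoothCharts he).mdifferentiableAt_symm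
      hw).hasMFDerivAt.comp w h1).mfderiv
  have h0 : planeLin (EuclideanSpace.single 0 (1 : ℝ)) = EuclideanSpace.single 0 (1 : ℝ) := by
    ext i; fin_cases i <;> simp [planeLin_apply, planePoint]
  have h1 : planeLin (EuclideanSpace.single 1 (1 : ℝ)) = EuclideanSpace.single 1 (1 : ℝ) := by
    ext i; fin_cases i <;> simp [planeLin_apply, planePoint]
  rw [gramDensity, areaDensity, Matrix.det_fin_two]
  simp only [gramMatrix, Matrix.of_apply, hd, ContinuousLinearMap.comp_apply, h0, h1]
  rfl

theorem isPatch_slice (he : e ∈ smoothCharts M) :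
    IsPatch g (sliceDom e) (sliceParam e) (fun x => planeProj (e x)) e.source where
  isOpen_dom := e.open_target.preimage planeLin.continuous
  isOpen_cod := e.open_source
  mapsTo := fun w hw => e.map_target hw
  leftInv := fun w hw => by rw [sliceParam, e.right_inv hw, planeProj_planePoint]
  mdiff := fun w hw => ((mdifferentiable_of_mem_smoothCharts he).mdifferentiableAt_symm hw).comp w
    (mdifferentiableAt_planePoint w)
  mdiff_inv := fun x hx => planeProj.differentiableAt.mdifferentiableAt.comp x
    ((mdifferentiable_of_mem_smoothCharts he).mdifferentiableAt hx)
  continuousOn_density := by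
    refine ContinuousOn.congr (f := areaDensity g e) (fun w hw => ?_)
      (fun w hw => gramDensity_sliceParam g he hw)
    have hc : ∀ i j, ContinuousAt (fun w => metricCoord g e i j (planePoint w)) w := fun i j =>
      ContinuousAt.comp (f := planePoint) (contDiffAt_metricCoord g he hw i j).continuousAt
        planeLin.continuous.continuousAt
    exact ((((hc 0 0).mul (hc 1 1)).sub ((hc 0 1).mul (hc 1 0))).sqrt).continuousWithinAt

variable [MeasurableSpace M]

theorem patchArea_eq (he : e ∈ smoothCharts M) :
    patchArea g e = patchMeasure g (sliceDom e) (sliceParam e) := by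
  have hm : MeasurableSet (sliceDom e) := (isPatch_slice g he).isOpen_dom.measurableSet
  rw [patchArea, patchMeasure]
  congr 1
  refine withDensity_congr_ae ?_
  filter_upwards [ae_restrict_mem hm] with w hw
  rw [gramDensity_sliceParam g he hw]

theorem surfaceArea_eq (A : Set M) :
    surfaceArea g A = ⨆ e : {e : OpenPartialHomeomorph M E3 // IsSliceChart A e},
      patchMeasure g (sliceDom e.1) (sliceParam e.1) := by
  rw [surfaceArea, iSup_subtype']
  exact iSup_congr fun e => patchArea_eq g e.2.1

variable [BorelSpace M]

variable {g} in
theorem IsPatch.setIntegral_eq {n : ℕ} {O : Set (EuclideanSpace ℝ (Fin n))}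
    {ψ : EuclideanSpace ℝ (Fin n) → M} {χ : M → EuclideanSpace ℝ (Fin n)} {U W : Set M}
    {μ : Measure M} (h : IsPatch g O ψ χ U) (hμ : μ.restrict U = patchMeasure g O ψ)
    (hW : MeasurableSet W) {f : M → ℝ} (hf : AEStronglyMeasurable f (μ.restrict W))
    (hf0 : ∀ x ∈ W, x ∉ U → f x = 0) :
    ∫ x in W, f x ∂μ = ∫ w in O, gramDensity g ψ w * W.indicator f (ψ w) := by
  have h1 : ∫ x in W, f x ∂μ = ∫ x in W ∩ U, f x ∂μ :=
    (setIntegral_eq_of_subset_of_forall_sdiff_eq_zero hW inter_subset_left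
      (fun x hx => hf0 x hx.1 fun hU => hx.2 ⟨hx.1, hU⟩))
  have h2 : ∫ x in W ∩ U, f x ∂μ = ∫ x, W.indicator f x ∂(patchMeasure g O ψ) := by
    rw [integral_indicator hW, ← hμ, Measure.restrict_restrict hW]
  rw [h1, h2, h.integral_patchMeasure]
  rw [aestronglyMeasurable_indicator_iff hW, ← hμ, Measure.restrict_restrict hW]
  exact hf.mono_measure (Measure.restrict_mono inter_subset_left le_rfl)

variable [SecondCountableTopology M]

/-- In each slice chart the area measure is the area of the patch. -/
theorem surfaceArea_restrict (h : IsSliceChart A e) :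
    (surfaceArea g A).restrict e.source = patchMeasure g (sliceDom e) (sliceParam e) := by
  rw [surfaceArea_eq]
  exact restrict_iSup_of_agree
    (fun e : {e : OpenPartialHomeomorph M E3 // IsSliceChart A e} =>
      patchMeasure g (sliceDom e.1) (sliceParam e.1))
    (fun e => e.1.source) (fun e => e.1.open_source)
    (fun e => (isPatch_slice g e.2.1).patchMeasure_restrict e.1.open_source.measurableSet
      (isPatch_slice g e.2.1).mapsTo)
    (fun e e' => (isPatch_slice g e.2.1).patchMeasure_restrict_comm (isPatch_slice g e'.2.1)
      (patchCompatible_slice e.2 e'.2) (patchCompatible_slice e'.2 e.2)) ⟨e, h⟩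

variable [T2Space M]

theorem volumeMeasure_lt_top {K : Set M} (hK : IsCompact K) : volumeMeasure g K < ⊤ := by
  have hloc : LocallyCompactSpace M := ChartedSpace.locallyCompactSpace E3 M
  refine hK.measure_lt_top_of_nhdsWithin fun x _ => ?_
  have he : chartAt E3 x ∈ smoothCharts M := IsManifold.chart_mem_maximalAtlas x
  obtain ⟨L, hL, hLs, hLc⟩ := local_compact_nhds
    ((chartAt E3 x).open_source.mem_nhds (mem_chart_source E3 x))
  refine ⟨L, mem_nhdsWithin_of_mem_nhds hL, ?_⟩
  rw [← inter_eq_left.2 hLs, ← Measure.restrict_apply hLc.measurableSet,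
    volumeMeasure_restrict g he]
  refine (isPatch_chart g he).patchMeasure_lt_top hLc.measurableSet hLc fun y hy => ?_
  exact ⟨_, (chartAt E3 x).map_source (hLs hy), (chartAt E3 x).left_inv (hLs hy)⟩

theorem surfaceArea_lt_top {A : Set M} (hA : IsClosedSurface A) : surfaceArea g A A < ⊤ := by
  have hloc : LocallyCompactSpace M := ChartedSpace.locallyCompactSpace E3 M
  refine hA.1.measure_lt_top_of_nhdsWithin fun x hx => ?_
  obtain ⟨e, he, hxe⟩ := hA.2 x hx
  obtain ⟨L, hL, hLs, hLc⟩ := local_compact_nhds (e.open_source.mem_nhds hxe)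
  have hc : IsCompact (L ∩ A) := hLc.inter hA.1
  refine ⟨L ∩ A, inter_comm A L ▸ inter_mem_nhdsWithin A hL, ?_⟩
  rw [← inter_eq_left.2 (inter_subset_left.trans hLs : L ∩ A ⊆ e.source),
    ← Measure.restrict_apply hc.measurableSet, surfaceArea_restrict g he]
  refine (isPatch_slice g he.1).patchMeasure_lt_top hc.measurableSet hc fun y hy => ?_
  exact ⟨_, he.eq_sliceParam hy.2 (hLs hy.1)⟩

end GlobalMeasures

/-! ### The divergence theorem in a boundary chart -/

section LocalDivergence

variable {M : Type*} [TopologicalSpace M] [ChartedSpace E3 M]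
  {e : OpenPartialHomeomorph M E3}

/-- The derivative `Y(ρ) = Y^i ∂_i ρ` of a function along a vector field. -/
def derivAlong (Y : VecField M) (ρ : M → ℝ) (x : M) : ℝ :=
  mfderiv (𝓡 3) 𝓘(ℝ, ℝ) ρ x (Y x)

variable {ρ : M → ℝ}

theorem derivAlong_symm (Y : VecField M) (he : e ∈ smoothCharts M) {u : E3} (hu : u ∈ e.target)
    (hρ : MDifferentiableAt (𝓡 3) 𝓘(ℝ, ℝ) ρ (e.symm u)) :
    derivAlong Y ρ (e.symm u) =
      ∑ i, partialDeriv i (fun v => ρ (e.symm v)) u * vecCoord Y e i u := by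
  have h1 : ∀ i, partialDeriv i (fun v => ρ (e.symm v)) u =
      mfderiv (𝓡 3) 𝓘(ℝ, ℝ) ρ (e.symm u) (coordVec e i u) := by
    intro i
    have h2 := mfderiv_comp u hρ
      ((mdifferentiable_of_mem_smoothCharts he).mdifferentiableAt_symm hu)
    rw [partialDeriv, ← mfderiv_eq_fderiv]
    exact congrArg (fun L : E3 →L[ℝ] ℝ => L (EuclideanSpace.single i (1 : ℝ))) h2
  let L : TangentSpace (𝓡 3) (e.symm u) →L[ℝ] ℝ := mfderiv (𝓡 3) 𝓘(ℝ, ℝ) ρ (e.symm u)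
  change L (Y (e.symm u)) = _
  conv_lhs => rw [eq_sum_coordVec he hu (Y (e.symm u))]
  simp only [map_sum, map_smul, smul_eq_mul, h1]
  exact Finset.sum_congr rfl fun i _ => mul_comm _ _

theorem contDiffAt_comp_symm (he : e ∈ smoothCharts M) {u : E3} (hu : u ∈ e.target)
    (hρ : ContMDiff (𝓡 3) 𝓘(ℝ, ℝ) ∞ ρ) : ContDiffAt ℝ ∞ (fun v => ρ (e.symm v)) u :=
  (hρ.contMDiffAt.comp u (contMDiffAt_symm he hu)).contDiffAt

variable [IsManifold (𝓡 3) ∞ M] (g : Metric3 M) {T : CovTensor2 M} {X : VecField M}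

theorem continuousAt_derivAlong_fluxField (hρ : ContMDiff (𝓡 3) 𝓘(ℝ, ℝ) ∞ ρ) {x : M}
    (hT : C1TensorAt T x) (hX : C1VecAt X x) :
    ContinuousAt (derivAlong (fluxField g T X) ρ) x := by
  let e := chartAt E3 x
  have he : e ∈ smoothCharts M := IsManifold.chart_mem_maximalAtlas x
  have hx : x ∈ e.source := mem_chart_source E3 x
  have hu : e x ∈ e.target := e.map_source hx
  have hxx : e.symm (e x) = x := e.left_inv hx
  have h1 : ContinuousAt (fun u => ∑ i, partialDeriv i (fun v => ρ (e.symm v)) u *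
      vecCoord (fluxField g T X) e i u) (e x) := by
    refine tendsto_finsetSum _ fun i _ => ContinuousAt.mul ?_ ?_
    · exact ((contDiffAt_comp_symm he hu hρ).fderiv_right (m := 0)
        (by simp)).continuousAt.clm_apply continuousAt_const
    · exact (contDiffAt_vecCoord_fluxField g he hu (hxx.symm ▸ hT) (hxx.symm ▸ hX) i).continuousAt
  have h2 : ContinuousAt (fun y => ∑ i, partialDeriv i (fun v => ρ (e.symm v)) (e y) *
      vecCoord (fluxField g T X) e i (e y)) x :=
    ContinuousAt.comp (f := e) h1 (e.continuousAt hx)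
  refine h2.congr ?_
  filter_upwards [e.open_source.mem_nhds hx] with y hy
  have h3 := derivAlong_symm (fluxField g T X) he (e.map_source hy)
    (ρ := ρ) (hρ.mdifferentiableAt (by simp))
  rw [← h3, e.left_inv hy]

variable {V W : Set M}

/-- The divergence theorem for `ρ Y` on `W`, where `Y` is the flux field and `ρ` is supported in a
boundary chart. As `div Y = 0` on `W`, the divergence of `ρ Y` is `Y(ρ)`. -/
theorem setIntegral_derivAlong_of_isBoundaryChart [SecondCountableTopology M] [T2Space M]
    [MeasurableSpace M] [BorelSpace M]
    (hXconf : IsConformalKillingOn g X V) (hTsymm : IsSymmetricOn T V)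
    (hTtrace : IsTracelessOn g T V) (hTdiv : IsDivergenceFreeOn g T V)
    (hWV : W ⊆ V) (hW : IsClosed W) (hTW : ∀ x ∈ W, C1TensorAt T x) (hXW : ∀ x ∈ W, C1VecAt X x)
    (he : IsBoundaryChart W e) (hT : ∀ x ∈ e.source, C1TensorAt T x)
    (hX : ∀ x ∈ e.source, C1VecAt X x) (hρ : ContMDiff (𝓡 3) 𝓘(ℝ, ℝ) ∞ ρ)
    (hc : HasCompactSupport ρ) (hsupp : tsupport ρ ⊆ e.source) :
    ∫ x in W, derivAlong (fluxField g T X) ρ x ∂(volumeMeasure g) =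
      ∫ w in sliceDom e, ρ (sliceParam e w) * fluxCoord g T X e 2 (planePoint w) := by
  set f : M → ℝ := derivAlong (fluxField g T X) ρ with hf
  have hfc : ContinuousOn f W := fun x hx =>
    (continuousAt_derivAlong_fluxField g hρ (hTW x hx) (hXW x hx)).continuousWithinAt
  have hρ0 : ∀ x, x ∉ tsupport ρ → ∀ᶠ y in nhds x, ρ y = 0 := fun x hx =>
    notMem_tsupport_iff_eventuallyEq.1 hx
  have hf0 : ∀ x, x ∉ e.source → f x = 0 := by
    intro x hx
    have h1 : ρ =ᶠ[nhds x] fun _ => 0 := hρ0 x fun h => hx (hsupp h)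
    simp only [hf, derivAlong]
    rw [h1.mfderiv_eq, mfderiv_const]
    rfl
  set G : Fin 3 → E3 → ℝ := fun i =>
    e.target.indicator fun u => ρ (e.symm u) * fluxCoord g T X e i u with hG
  let K : Set E3 := e '' tsupport ρ
  have hK : IsCompact K := IsCompact.image_of_continuousOn hc (e.continuousOn.mono hsupp)
  have hGK : ∀ i u, u ∉ K → G i u = 0 := by
    intro i u hu
    by_cases hut : u ∈ e.target
    · simp only [hG, indicator_of_mem hut]
      have h0 : ρ (e.symm u) = 0 :=
        image_eq_zero_of_notMem_tsupport fun h => hu ⟨_, h, e.right_inv hut⟩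
      rw [h0, zero_mul]
    · exact indicator_of_notMem hut _
  have hKt : K ⊆ e.target := by
    rintro _ ⟨x, hx, rfl⟩
    exact e.map_source (hsupp hx)
  have hGe : ∀ i, ∀ u ∈ e.target,
      G i =ᶠ[nhds u] fun v => ρ (e.symm v) * fluxCoord g T X e i v := by
    intro i u hu
    filter_upwards [e.open_target.mem_nhds hu] with v hv
    simp only [hG, indicator_of_mem hv]
  have hFd : ∀ i, ∀ u ∈ e.target, ContDiffAt ℝ 1 (fluxCoord g T X e i) u := fun i u hu =>
    contDiffAt_fluxCoord g he.1 hu (hT _ (e.map_target hu)) (hX _ (e.map_target hu)) i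
  have hGd : ∀ i, ContDiff ℝ 1 (G i) := by
    intro i
    rw [contDiff_iff_contDiffAt]
    intro u
    by_cases hut : u ∈ e.target
    · exact ((((contDiffAt_comp_symm he.1 hut hρ).of_le (by simp)).mul
        (hFd i u hut))).congr_of_eventuallyEq (hGe i u hut)
    · have h1 : G i =ᶠ[nhds u] fun _ => 0 := by
        filter_upwards [hK.isClosed.isOpen_compl.mem_nhds fun h => hut (hKt h)] with v hv
        exact hGK i v hv
      exact contDiffAt_const.congr_of_eventuallyEq h1
  have hGc : ∀ i, HasCompactSupport (G i) := fun i => HasCompactSupport.intro hK (hGK i)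
  have hdiv := integral_halfSpace_divergence G hGd hGc
  have hpatch := isPatch_chart g he.1
  rw [hpatch.setIntegral_eq (volumeMeasure_restrict g he.1) hW.measurableSet
    (hfc.aestronglyMeasurable hW.measurableSet) (fun x _ hx => hf0 x hx)]
  have hms : MeasurableSet (sliceDom e) := (isPatch_slice g he.1).isOpen_dom.measurableSet
  have hR : ∫ w, G 2 (planePoint w) =
      ∫ w in sliceDom e, ρ (sliceParam e w) * fluxCoord g T X e 2 (planePoint w) := by
    rw [← integral_indicator hms]
    rfl
  rw [← hR, ← hdiv, ← integral_indicator e.open_target.measurableSet,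
    ← integral_indicator (measurableSet_le (by fun_prop) measurable_const)]
  congr 1
  funext u
  by_cases hut : u ∈ e.target
  · rw [indicator_of_mem hut]
    have hmem : e.symm u ∈ W ↔ u 2 ≤ 0 := by
      rw [he.2 _ (e.map_target hut), e.right_inv hut]
    by_cases hu : u 2 ≤ 0
    · have huW := hmem.2 hu
      rw [indicator_of_mem huW, indicator_of_mem (show u ∈ {u : E3 | u 2 ≤ 0} from hu)]
      have h0 := sum_partialDeriv_fluxCoord g hXconf hTsymm hTtrace hTdiv he.1 hut (hWV huW)
        (hTW _ huW) (hXW _ huW)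
      have h1 : ∀ i, partialDeriv i (G i) u =
          partialDeriv i (fun v => ρ (e.symm v)) u * fluxCoord g T X e i u +
            ρ (e.symm u) * partialDeriv i (fluxCoord g T X e i) u := by
        intro i
        rw [partialDeriv, (hGe i u hut).fderiv_eq, ← partialDeriv,
          partialDeriv_mul ((contDiffAt_comp_symm he.1 hut hρ).differentiableAt (by simp))
            ((hFd i u hut).differentiableAt (by simp))]
      simp only [h1, Finset.sum_add_distrib]
      rw [← Finset.mul_sum, h0, mul_zero, add_zero, hf, derivAlong_symm _ he.1 hut
        (hρ.mdifferentiableAt (by simp)), Finset.mul_sum]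
      refine Finset.sum_congr rfl fun i _ => ?_
      rw [fluxCoord, gramDensity, gramMatrix_chart_symm]
      ring
    · rw [indicator_of_notMem (fun h => hu (hmem.1 h)),
        indicator_of_notMem (show u ∉ {u : E3 | u 2 ≤ 0} from hu), mul_zero]
  · rw [indicator_of_notMem hut]
    have h1 : ∀ i, partialDeriv i (G i) u = 0 := by
      intro i
      have h2 : G i =ᶠ[nhds u] fun _ => 0 := by
        filter_upwards [hK.isClosed.isOpen_compl.mem_nhds fun h => hut (hKt h)] with v hv
        exact hGK i v hv
      rw [partialDeriv, h2.fderiv_eq]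
      simp
    rw [indicator_apply]
    simp [h1]

end LocalDivergence

/-! ### The flux through a surface in a slice chart -/

section LocalFlux

variable {M : Type*} [TopologicalSpace M] [ChartedSpace E3 M] [IsManifold (𝓡 3) ∞ M]
  {e : OpenPartialHomeomorph M E3} {g : Metric3 M} {T : CovTensor2 M} {X : VecField M} {ρ : M → ℝ}

/-- The flux density times the area density is `± √(det γ) Y²`, the sign `s` being that of `n²`.
As `n` is orthogonal to `∂_0` and `∂_1`, its covector is `(0, 0, ν)` with `γ^{22} ν² = 1`, and the
area density is `√(γ^{22} det γ)`. -/
theorem areaDensity_mul_fluxDensity (S : OrientedClosedSurface g) (he : IsSliceChart S.carrier e)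
    {w : EuclideanSpace ℝ (Fin 2)} (hw : w ∈ sliceDom e) {s : ℝ} (hs : s ^ 2 = 1)
    (hpos : 0 < s * vecComp e (sliceParam e w) (S.normal (sliceParam e w)) 2) :
    areaDensity g e w * S.fluxDensity T X (sliceParam e w) =
      s * fluxCoord g T X e 2 (planePoint w) := by
  set u := planePoint w with hu_def
  have hu : u ∈ e.target := hw
  have hS : e.symm u ∈ S.carrier := he.sliceParam_mem hw
  obtain ⟨h0, h1⟩ := S.orthogonal e he u hu hS
  set n : TangentSpace (𝓡 3) (e.symm u) := S.normal (e.symm u) with hn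
  set ν : ℝ := g.inner (e.symm u) n (coordVec e 2 u) with hν
  have hn2 : vecComp e (e.symm u) n 2 = invMetricCoord g e 2 2 u * ν := by
    rw [vecComp_eq_sum_invMetricCoord g he.1 hu, Fin.sum_univ_three, h0, h1]
    simp [hν]
  have hinner : ∀ y : TangentSpace (𝓡 3) (e.symm u), g.inner (e.symm u) n y =
      ν * vecComp e (e.symm u) y 2 := by
    intro y
    rw [apply_vec_eq_sum g.inner he.1 hu, Fin.sum_univ_three, h0, h1]
    simp [hν]
  have hunit : ν * (invMetricCoord g e 2 2 u * ν) = 1 := by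
    rw [← hn2, ← hinner]
    exact S.unit_normal _ hS
  have hflux : S.fluxDensity T X (sliceParam e w) = ν * vecCoord (fluxField g T X) e 2 u := by
    change T (e.symm u) n (X (e.symm u)) = _
    rw [← inner_fluxField g, g.symm, hinner]
    rfl
  have hpos' : 0 < s * (invMetricCoord g e 2 2 u * ν) := by
    rw [← hn2]; exact hpos
  set h22 := invMetricCoord g e 2 2 u with hh22
  have hD := det_metricMatrix_pos g he.1 hu
  have h22pos : 0 < h22 := by
    by_contra hneg
    have : ν * (h22 * ν) ≤ 0 := by nlinarith [sq_nonneg ν]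
    linarith
  have harea : areaDensity g e w = √(metricMatrix g e u).det * √h22 := by
    rw [← Real.sqrt_mul hD.le, areaDensity]
    congr 1
    have : (metricMatrix g e u).det * h22 = (metricMatrix g e u).adjugate 2 2 := by
      change (metricMatrix g e u).det * (metricMatrix g e u)⁻¹ 2 2 = _
      rw [Matrix.inv_def, Ring.inverse_eq_inv', Matrix.smul_apply, smul_eq_mul,
        mul_inv_cancel_left₀ hD.ne']
    rw [this, Matrix.adjugate_fin_three]
    simp only [metricMatrix, hu_def]
    rfl
  have hsν : √h22 * ν = s := by
    have h3 : √h22 * √h22 = h22 := Real.mul_self_sqrt h22pos.le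
    have h4 : 0 < √h22 := Real.sqrt_pos.2 h22pos
    have h5 : 0 < s * (√h22 * ν) := by
      have : s * (h22 * ν) = √h22 * (s * (√h22 * ν)) :=
        calc s * (h22 * ν) = s * (√h22 * √h22 * ν) := by rw [h3]
          _ = √h22 * (s * (√h22 * ν)) := by ring
      rw [this] at hpos'
      exact (pos_iff_pos_of_mul_pos hpos').1 h4
    have h6 : (√h22 * ν) ^ 2 = 1 := by
      rw [← hunit]
      nth_rewrite 2 [← h3]
      ring
    have h7 : (s - √h22 * ν) * (s + √h22 * ν) = 0 := by nlinarith
    rcases mul_eq_zero.1 h7 with h | h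
    · linarith
    · exfalso
      have : √h22 * ν = -s := by linarith
      rw [this] at h5
      nlinarith
  rw [harea, hflux, fluxCoord, ← hsν]
  ring

/-- The flux of `ρ Y` through `S` when `ρ` is supported in a slice chart `e`; the sign `s` tells
whether the normal of `S` points towards increasing or decreasing `u²`. -/
theorem setIntegral_mul_fluxDensity_of_isSliceChart [SecondCountableTopology M] [T2Space M]
    [MeasurableSpace M] [BorelSpace M] (S : OrientedClosedSurface g)
    (he : IsSliceChart S.carrier e) {s : ℝ} (hs : s ^ 2 = 1)
    (hpos : ∀ x ∈ e.source ∩ S.carrier, 0 < s * vecComp e x (S.normal x) 2)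
    (hcont : ContinuousOn (fun x => ρ x * S.fluxDensity T X x) S.carrier)
    (hρ : ∀ x, x ∉ e.source → ρ x = 0) :
    ∫ x in S.carrier, ρ x * S.fluxDensity T X x ∂(surfaceArea g S.carrier) =
      s * ∫ w in sliceDom e, ρ (sliceParam e w) * fluxCoord g T X e 2 (planePoint w) := by
  have hm : MeasurableSet S.carrier := S.isClosedSurface.1.measurableSet
  have hp := isPatch_slice g he.1
  rw [hp.setIntegral_eq (surfaceArea_restrict g he) hm (hcont.aestronglyMeasurable hm)
    (fun x _ hx => by rw [hρ x hx, zero_mul]), ← integral_const_mul]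
  refine setIntegral_congr_fun hp.isOpen_dom.measurableSet fun w hw => ?_
  have hS := he.sliceParam_mem hw
  rw [gramDensity_sliceParam g he.1 hw, indicator_of_mem hS]
  have h := areaDensity_mul_fluxDensity (T := T) (X := X) S he hw hs
    (hpos _ ⟨hp.mapsTo hw, hS⟩)
  calc _ = ρ (sliceParam e w) * (areaDensity g e w * S.fluxDensity T X (sliceParam e w)) := by ring
    _ = _ := by rw [h]; ring

theorem continuousOn_fluxDensity (S : OrientedClosedSurface g)
    (hT : ∀ x ∈ S.carrier, C1TensorAt T x) (hX : ∀ x ∈ S.carrier, C1VecAt X x) :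
    ContinuousOn (S.fluxDensity T X) S.carrier := by
  intro x hx
  have h := ContinuousWithinAt.clm_bundle_apply₂ (F₁ := E3) (F₂ := E3) (F₃ := ℝ)
    (E₁ := fun x : M => TangentSpace (𝓡 3) x) (E₂ := fun x : M => TangentSpace (𝓡 3) x)
    (E₃ := fun _ : M => ℝ) (b := fun x : M => x) (ψ := T)
    (v := S.normal) (w := X)
    (hT x hx).continuousAt.continuousWithinAt (S.continuousOn_normal x hx)
    (hX x hx).continuousAt.continuousWithinAt
  rw [FiberBundle.continuousWithinAt_totalSpace] at h
  exact h.2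

end LocalFlux

/-! ### Boundary charts and the global argument -/

section BoundaryCharts

variable {M : Type*} [TopologicalSpace M] [ChartedSpace E3 M] {e : OpenPartialHomeomorph M E3}
  {A W : Set M}

theorem IsBoundaryChart.mem_frontier_iff (he : IsBoundaryChart W e) {x : M} (hx : x ∈ e.source) :
    x ∈ frontier W ↔ e x 2 = 0 := by
  have hcont : ContinuousAt (fun y => e y 2) x :=
    (by fun_prop : Continuous fun u : E3 => u 2).continuousAt.comp (e.continuousAt hx)
  have hsrc := e.open_source.mem_nhds hx
  constructor
  · intro h
    rcases lt_trichotomy (e x 2) 0 with hlt | heq | hgt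
    · exfalso
      refine h.2 (mem_interior_iff_mem_nhds.2 ?_)
      filter_upwards [hsrc, hcont.eventually_lt_const hlt] with y hy hy2
      exact (he.2 y hy).2 hy2.le
    · exact heq
    · exfalso
      have h1 : ∀ᶠ y in nhds x, y ∉ W := by
        filter_upwards [hsrc, hcont.eventually_const_lt hgt] with y hy hy2 hyW
        exact not_lt.2 ((he.2 y hy).1 hyW) hy2
      exact mem_closure_iff_frequently.1 h.1 h1
  · intro h
    refine ⟨subset_closure ((he.2 x hx).2 h.le), fun hint => ?_⟩
    let c : ℝ → E3 := fun t => e x + t • EuclideanSpace.single 2 (1 : ℝ)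
    have hc : Continuous c := by fun_prop
    have hc0 : c 0 = e x := by simp [c]
    have ht : ∀ᶠ t in nhds (0 : ℝ), c t ∈ e.target ∧ e.symm (c t) ∈ W := by
      have h1 : ∀ᶠ u in nhds (c 0), u ∈ e.target ∧ e.symm u ∈ W := by
        rw [hc0]
        refine Filter.Eventually.and (e.open_target.mem_nhds (e.map_source hx)) ?_
        refine (e.continuousAt_symm (e.map_source hx)).eventually ?_
        rw [e.left_inv hx]
        exact mem_interior_iff_mem_nhds.1 hint
      exact hc.continuousAt.eventually h1
    obtain ⟨ε, hε, hball⟩ := Metric.eventually_nhds_iff.1 ht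
    obtain ⟨h1, h2⟩ := hball (y := ε / 2) (by
      rw [Real.dist_eq, sub_zero, abs_of_pos (by positivity)]; linarith)
    have h3 := (he.2 _ (e.map_target h1)).1 h2
    rw [e.right_inv h1] at h3
    have h4 : c (ε / 2) 2 = ε / 2 := by simp [c, h]
    rw [h4] at h3
    linarith

theorem IsBoundaryChart.restr (he : IsBoundaryChart W e) {s : Set M} (hs : IsOpen s) :
    IsBoundaryChart W (e.restr s) :=
  ⟨restr_mem_maximalAtlas _ he.1 hs, fun x hx => he.2 x (by
    rw [e.restr_source' s hs] at hx; exact hx.1)⟩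

theorem IsBoundaryChart.isSliceChart (he : IsBoundaryChart W e)
    (hA : ∀ x ∈ e.source, x ∈ frontier W ↔ x ∈ A) : IsSliceChart A e :=
  ⟨he.1, fun x hx => by rw [← hA x hx, he.mem_frontier_iff hx]⟩

/-- Interior points also have boundary charts: translate a chart so that `u² < 0` near the point.
The part of the boundary in such a chart is empty. -/
theorem exists_isBoundaryChart_of_mem_interior [IsManifold (𝓡 3) ∞ M] {x : M}
    (hx : x ∈ interior W) : ∃ e, IsBoundaryChart W e ∧ x ∈ e.source := by
  let e₀ := chartAt E3 x
  have he₀ : e₀ ∈ smoothCharts M := IsManifold.chart_mem_maximalAtlas x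
  have hx₀ : x ∈ e₀.source := mem_chart_source E3 x
  let c : E3 := -((e₀ x 2 + 1) • EuclideanSpace.single 2 (1 : ℝ))
  let τ : E3 ≃ₜ E3 := Homeomorph.addRight c
  let e₁ := e₀.transHomeomorph τ
  have he₁ : e₁ ∈ smoothCharts M := by
    refine OpenPartialHomeomorph.mem_maximalAtlas_of_contMDiffOn (I := 𝓡 3) (n := ∞) _ ?_ ?_
    · have h1 : ContMDiff 𝓘(ℝ, E3) 𝓘(ℝ, E3) ∞ τ :=
        (contDiff_id.add contDiff_const).contMDiff
      exact h1.comp_contMDiffOn (contMDiffOn_of_mem_maximalAtlas he₀)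
    · have h1 : ContMDiff 𝓘(ℝ, E3) 𝓘(ℝ, E3) ∞ τ.symm :=
        (contDiff_id.add contDiff_const).contMDiff
      exact (contMDiffOn_symm_of_mem_maximalAtlas he₀).comp h1.contMDiffOn fun u hu => hu
  have hval : ∀ y, e₁ y 2 = e₀ y 2 - (e₀ x 2 + 1) := by
    intro y
    change (e₀ y + c) 2 = _
    simp [c]
    ring
  have hcont : ContinuousOn (fun y => e₁ y 2) e₁.source :=
    (by fun_prop : Continuous fun u : E3 => u 2).comp_continuousOn e₁.continuousOn
  have ho : IsOpen (e₁.source ∩ (fun y => e₁ y 2) ⁻¹' Iio 0) :=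
    hcont.isOpen_inter_preimage e₁.open_source isOpen_Iio
  have ho2 := ho.inter (isOpen_interior (s := W))
  refine ⟨e₁.restr (e₁.source ∩ (fun y => e₁ y 2) ⁻¹' Iio 0 ∩ interior W),
    ⟨restr_mem_maximalAtlas _ he₁ ho2, fun y hy => ?_⟩, ?_⟩
  · rw [e₁.restr_source' _ ho2] at hy
    exact iff_of_true (interior_subset hy.2.2) (le_of_lt hy.2.1.2)
  · rw [e₁.restr_source' _ ho2]
    refine ⟨hx₀, ⟨hx₀, ?_⟩, hx⟩
    rw [mem_preimage, hval, mem_Iio]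
    linarith

set_option synthInstance.maxHeartbeats 200000 in
theorem isOpen_setOf_C1 [IsManifold (𝓡 3) ∞ M] (T : CovTensor2 M) (X : VecField M) :
    IsOpen {x | C1TensorAt T x ∧ C1VecAt X x} := by
  rw [isOpen_iff_mem_nhds]
  rintro x ⟨hT, hX⟩
  have hT' : ∀ᶠ y in nhds x, C1TensorAt T y := (contMDiffAt_iff_contMDiffAt_nhds (by simp)).1 hT
  have hX' : ∀ᶠ y in nhds x, C1VecAt X y := (contMDiffAt_iff_contMDiffAt_nhds (by simp)).1 hX
  exact hT'.and hX'

/-- The derivatives of a partition of unity add up to zero. -/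
theorem sum_derivAlong_eq_zero [IsManifold (𝓡 3) ∞ M] {ι : Type*} [Fintype ι] {ρ : ι → M → ℝ}
    (hρ : ∀ i, ContMDiff (𝓡 3) 𝓘(ℝ, ℝ) ∞ (ρ i)) {x : M}
    (hsum : ∀ᶠ y in nhds x, ∑ i, ρ i y = 1) (Y : VecField M) :
    ∑ i, derivAlong Y (ρ i) x = 0 := by
  let e := chartAt E3 x
  have he : e ∈ smoothCharts M := IsManifold.chart_mem_maximalAtlas x
  have hx : x ∈ e.source := mem_chart_source E3 x
  have hu : e x ∈ e.target := e.map_source hx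
  have h1 : ∀ i, derivAlong Y (ρ i) x =
      ∑ k, partialDeriv k (fun v => ρ i (e.symm v)) (e x) * vecCoord Y e k (e x) := by
    intro i
    rw [← derivAlong_symm Y he hu ((hρ i).mdifferentiable (by simp) _), e.left_inv hx]
  simp only [h1]
  rw [Finset.sum_comm]
  refine Finset.sum_eq_zero fun k _ => ?_
  rw [← Finset.sum_mul, ← partialDeriv_sum fun i _ =>
    (contDiffAt_comp_symm he hu (hρ i)).differentiableAt (by simp)]
  have h2 : (fun v => ∑ i, ρ i (e.symm v)) =ᶠ[nhds (e x)] fun _ => 1 := by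
    refine (e.continuousAt_symm hu).eventually (p := fun y => ∑ i, ρ i y = 1) ?_
    rw [e.left_inv hx]
    exact hsum
  rw [partialDeriv, h2.fderiv_eq]
  simp

end BoundaryCharts

section Gluing

variable {M : Type*} [TopologicalSpace M] [T2Space M] [SecondCountableTopology M]
  [ChartedSpace E3 M] [IsManifold (𝓡 3) ∞ M] [MeasurableSpace M] [BorelSpace M]
  {g : Metric3 M} {V : Set M} {T : CovTensor2 M} {X : VecField M}

theorem integrableOn_fluxDensity (S : OrientedClosedSurface g)
    (hT : ∀ x ∈ S.carrier, C1TensorAt T x) (hX : ∀ x ∈ S.carrier, C1VecAt X x) :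
    IntegrableOn (S.fluxDensity T X) S.carrier (surfaceArea g S.carrier) :=
  integrableOn_of_continuousOn S.isClosedSurface.1 (surfaceArea_lt_top g S.isClosedSurface)
    (continuousOn_fluxDensity S hT hX)

/-- The charges of two surfaces that limit a volume in `V` agree: the divergence theorem for the
divergence-free flux field, by a partition of unity. -/
theorem Cobound.charge_eq
    (hXconf : IsConformalKillingOn g X V) (hTsymm : IsSymmetricOn T V)
    (hTtrace : IsTracelessOn g T V) (hTdiv : IsDivergenceFreeOn g T V)
    (hTV : ∀ x ∈ V, C1TensorAt T x) (hXV : ∀ x ∈ V, C1VecAt X x)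
    {S₁ S₂ : OrientedClosedSurface g} (h : Cobound V S₁ S₂) : S₁.charge T X = S₂.charge T X := by
  obtain ⟨W, ⟨hWc, hWb⟩, hWV, hfr, hdisj, hnor⟩ := h
  have hWcl : IsClosed W := hWc.isClosed
  have hfrW : frontier W ⊆ W := hWcl.frontier_subset
  have hS₁W : S₁.carrier ⊆ W := (subset_union_left.trans hfr.ge).trans hfrW
  have hS₂W : S₂.carrier ⊆ W := (subset_union_right.trans hfr.ge).trans hfrW
  have hS₁c : IsClosed S₁.carrier := S₁.isClosedSurface.1.isClosed
  have hS₂c : IsClosed S₂.carrier := S₂.isClosedSurface.1.isClosed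
  have hf₁ := continuousOn_fluxDensity (T := T) (X := X) S₁ (fun x hx => hTV x (hWV (hS₁W hx)))
    fun x hx => hXV x (hWV (hS₁W hx))
  have hf₂ := continuousOn_fluxDensity (T := T) (X := X) S₂ (fun x hx => hTV x (hWV (hS₂W hx)))
    fun x hx => hXV x (hWV (hS₂W hx))
  have hO := isOpen_setOf_C1 T X
  set O : Set M := {x | C1TensorAt T x ∧ C1VecAt X x} with hO_def
  have hWO : W ⊆ O := fun x hx => ⟨hTV x (hWV hx), hXV x (hWV hx)⟩
  -- Shrunk so as to avoid one of the two surfaces, a boundary chart is a slice chart of the other.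
  have hchart : ∀ x ∈ W, ∃ e, IsBoundaryChart W e ∧ x ∈ e.source ∧ e.source ⊆ O ∧
      (Disjoint e.source S₁.carrier ∨ Disjoint e.source S₂.carrier) := by
    intro x hx
    have h1 : ∃ e, IsBoundaryChart W e ∧ x ∈ e.source := by
      by_cases hxf : x ∈ frontier W
      · exact hWb x hxf
      · refine exists_isBoundaryChart_of_mem_interior ?_
        by_contra hxi
        exact hxf ⟨subset_closure hx, hxi⟩
    obtain ⟨e, he, hxe⟩ := h1
    by_cases hx1 : x ∈ S₁.carrier
    · have ho := hO.inter hS₂c.isOpen_compl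
      refine ⟨e.restr (O ∩ S₂.carrierᶜ), he.restr ho, ?_, ?_, Or.inr ?_⟩ <;>
        rw [e.restr_source' _ ho]
      · exact ⟨hxe, hWO hx, disjoint_left.1 hdisj hx1⟩
      · exact fun y hy => hy.2.1
      · exact disjoint_left.2 fun y hy => hy.2.2
    · have ho := hO.inter hS₁c.isOpen_compl
      refine ⟨e.restr (O ∩ S₁.carrierᶜ), he.restr ho, ?_, ?_, Or.inl ?_⟩ <;>
        rw [e.restr_source' _ ho]
      · exact ⟨hxe, hWO hx, hx1⟩
      · exact fun y hy => hy.2.1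
      · exact disjoint_left.2 fun y hy => hy.2.2
  have hlocal : ∀ e, IsBoundaryChart W e → e.source ⊆ O →
      (Disjoint e.source S₁.carrier ∨ Disjoint e.source S₂.carrier) → ∀ ρ : M → ℝ,
      ContMDiff (𝓡 3) 𝓘(ℝ, ℝ) ∞ ρ → HasCompactSupport ρ → tsupport ρ ⊆ e.source →
      ∫ x in W, derivAlong (fluxField g T X) ρ x ∂(volumeMeasure g) =
        ∫ x in S₂.carrier, ρ x * S₂.fluxDensity T X x ∂(surfaceArea g S₂.carrier) -
        ∫ x in S₁.carrier, ρ x * S₁.fluxDensity T X x ∂(surfaceArea g S₁.carrier) := by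
    intro e he heO hd ρ hρ hρc hρs
    have hρ0 : ∀ x, x ∉ e.source → ρ x = 0 := fun x hx =>
      image_eq_zero_of_notMem_tsupport fun h => hx (hρs h)
    have hz : ∀ S : OrientedClosedSurface g, Disjoint e.source S.carrier →
        ∫ x in S.carrier, ρ x * S.fluxDensity T X x ∂(surfaceArea g S.carrier) = 0 := by
      intro S hS
      refine (setIntegral_congr_fun S.isClosedSurface.1.measurableSet fun x hx => ?_).trans
        (integral_zero _ _)
      change ρ x * _ = 0
      rw [hρ0 x (disjoint_right.1 hS hx), zero_mul]
    rw [setIntegral_derivAlong_of_isBoundaryChart g hXconf hTsymm hTtrace hTdiv hWV hWcl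
      (fun x hx => (hWO hx).1) (fun x hx => (hWO hx).2) he (fun x hx => (heO hx).1)
      (fun x hx => (heO hx).2) hρ hρc hρs]
    rcases hd with hd | hd
    · have hsl : IsSliceChart S₂.carrier e := he.isSliceChart fun x hx => by
        rw [hfr]
        exact or_iff_right (disjoint_left.1 hd hx)
      rw [hz S₁ hd, setIntegral_mul_fluxDensity_of_isSliceChart S₂ hsl (s := 1) (by norm_num)
        (fun x hx => by rw [one_mul]; exact (hnor e he).2 x hx)
        (hρ.continuous.continuousOn.mul hf₂) hρ0]
      ring
    · have hsl : IsSliceChart S₁.carrier e := he.isSliceChart fun x hx => by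
        rw [hfr]
        exact or_iff_left (disjoint_left.1 hd hx)
      rw [hz S₂ hd, setIntegral_mul_fluxDensity_of_isSliceChart S₁ hsl (s := -1) (by norm_num)
        (fun x hx => by have := (hnor e he).1 x hx; linarith)
        (hρ.continuous.continuousOn.mul hf₁) hρ0]
      ring
  -- The partition of unity adds up to `1` on a neighbourhood `L` of `W`, not just on `W`, so that
  -- its derivatives cancel at the boundary points as well.
  have hloc : LocallyCompactSpace M := ChartedSpace.locallyCompactSpace E3 M
  choose e he hxe heO hed using fun x : W => hchart x x.2
  have hcpt : ∀ x : W, ∃ K, K ∈ nhds (x : M) ∧ K ⊆ (e x).source ∧ IsCompact K := fun x =>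
    local_compact_nhds ((e x).open_source.mem_nhds (hxe x))
  choose K hKn hKs hKc using hcpt
  obtain ⟨t, ht⟩ := hWc.elim_nhds_subcover' (fun x hx => interior (K ⟨x, hx⟩))
    fun x hx => interior_mem_nhds.2 (hKn ⟨x, hx⟩)
  have hcov : W ⊆ ⋃ i : t, interior (K i) := by
    intro x hx
    obtain ⟨i, hi, hxi⟩ := mem_iUnion₂.1 (ht hx)
    exact mem_iUnion.2 ⟨⟨i, hi⟩, hxi⟩
  obtain ⟨L, hLc, hWL, hLU⟩ := exists_compact_between hWc
    (isOpen_iUnion fun i : t => isOpen_interior) hcov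
  obtain ⟨ρ, hρ⟩ := SmoothPartitionOfUnity.exists_isSubordinate (𝓡 3) hLc.isClosed
    (fun i : t => interior (K i)) (fun _ => isOpen_interior) hLU
  have hρK : ∀ i : t, tsupport (ρ i) ⊆ K i := fun i => (hρ i).trans interior_subset
  have hρc : ∀ i : t, HasCompactSupport (ρ i) := fun i =>
    (hKc i).of_isClosed_subset (isClosed_tsupport _) (hρK i)
  have hρm : ∀ i : t, ContMDiff (𝓡 3) 𝓘(ℝ, ℝ) ∞ (ρ i) := fun i => (ρ i).contMDiff
  have hone : ∀ x ∈ L, ∑ i, ρ i x = 1 := fun x hx => by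
    rw [← ρ.sum_eq_one hx, finsum_eq_sum_of_fintype]
  have hi : ∀ i : t, ∫ x in W, derivAlong (fluxField g T X) (ρ i) x ∂(volumeMeasure g) =
        ∫ x in S₂.carrier, ρ i x * S₂.fluxDensity T X x ∂(surfaceArea g S₂.carrier) -
        ∫ x in S₁.carrier, ρ i x * S₁.fluxDensity T X x ∂(surfaceArea g S₁.carrier) := fun i =>
    hlocal (e i) (he i) (heO i) (hed i) (ρ i) (hρm i) (hρc i)
      ((hρK i).trans (hKs i))
  have hvol : ∑ i, ∫ x in W, derivAlong (fluxField g T X) (ρ i) x ∂(volumeMeasure g) = 0 := by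
    rw [← integral_finsetSum]
    · refine (setIntegral_congr_fun hWcl.measurableSet fun x hx => ?_).trans (integral_zero _ _)
      refine sum_derivAlong_eq_zero hρm ?_ _
      filter_upwards [mem_interior_iff_mem_nhds.1 (hWL hx)] with y hy using hone y hy
    · intro i _
      exact integrableOn_of_continuousOn hWc (volumeMeasure_lt_top g hWc) fun x hx =>
        (continuousAt_derivAlong_fluxField g (hρm i) (hWO hx).1 (hWO hx).2).continuousWithinAt
  have hsurf : ∀ S : OrientedClosedSurface g, S.carrier ⊆ W →
      ContinuousOn (S.fluxDensity T X) S.carrier →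
      ∑ i, ∫ x in S.carrier, ρ i x * S.fluxDensity T X x ∂(surfaceArea g S.carrier) =
        S.charge T X := by
    intro S hS hf
    rw [← integral_finsetSum]
    · refine setIntegral_congr_fun S.isClosedSurface.1.measurableSet fun x hx => ?_
      change ∑ i, ρ i x * S.fluxDensity T X x = _
      rw [← Finset.sum_mul, hone x (interior_subset (hWL (hS hx))), one_mul]
    · intro i _
      exact integrableOn_of_continuousOn S.isClosedSurface.1
        (surfaceArea_lt_top g S.isClosedSurface) ((hρm i).continuous.continuousOn.mul hf)
  simp only [hi, Finset.sum_sub_distrib] at hvol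
  rw [hsurf S₂ hS₂W hf₂, hsurf S₁ hS₁W hf₁] at hvol
  linarith

end Gluing

end

theorem proposition3p1 {M : Type*} [TopologicalSpace M] [T2Space M] [SecondCountableTopology M]
    [ChartedSpace E3 M] [IsManifold (𝓡 3) ∞ M] [MeasurableSpace M] [BorelSpace M]
    (g : Metric3 M) (V : Set M)
    (X : VecField M) (hX : SmoothVecNear X V) (hXconf : IsConformalKillingOn g X V)
    (T : CovTensor2 M) (hT : SmoothTensorNear T V) (hTsymm : IsSymmetricOn T V)
    (hTtrace : IsTracelessOn g T V) (hTdiv : IsDivergenceFreeOn g T V) :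
    (∀ S : OrientedClosedSurface g, S.carrier ⊆ V →
      IntegrableOn (S.fluxDensity T X) S.carrier (surfaceArea g S.carrier)) ∧
    (∀ S₁ S₂ : OrientedClosedSurface g, S₁.carrier ⊆ V → S₂.carrier ⊆ V →
      HomologousIn V S₁ S₂ → S₁.charge T X = S₂.charge T X) := by
  have hTV : ∀ x ∈ V, C1TensorAt T x := fun x hx => (hT x hx).of_le (by simp)
  have hXV : ∀ x ∈ V, C1VecAt X x := fun x hx => (hX x hx).of_le (by simp)
  refine ⟨fun S hS => integrableOn_fluxDensity S (fun x hx => hTV x (hS hx))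
    fun x hx => hXV x (hS hx), fun S₁ S₂ h₁ h₂ h => ?_⟩
  clear h₁ h₂
  induction h with
  | rel _ _ h => exact h.charge_eq hXconf hTsymm hTtrace hTdiv hTV hXV
  | refl _ => rfl
  | symm _ _ _ ih => exact ih.symm
  | trans _ _ _ _ _ ih₁ ih₂ => exact ih₁.trans ih₂
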